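/- Write $\log n$ for $\max\{1,\lceil\log_2 n\rceil\}$. A \emph{parameterised function} is a function $F\colon\{0,1\}^*\times\mathbb N\to\mathbb N$. The sum and the product of two parameterised functions are taken pointwise. \textbf{Machines.} A machine is a deterministic multi-tape Turing machine $M$ working on inputs $(x,k)\in\{0,1\}^*\times\mathbb N$, given as the word $x\#\mathrm{bin}(k)$, with random access to the input. It has finitely many work tapes, a random access tape (the input letter at the position whose index is written on this tape is available in each step), a relation query tape (on which membership of a tuple in a relation of the structure read off from $x$ can be queried in one step; the assignment of relations to words $x$ is arbitrary but fixed, and for plain word inputs there are no relations), and a read-only one-sided infinite choice tape holding bits, whose head starts on a left end marker. A \emph{nondeterministic step} is a step in which the head of the choice tape moves to a cell not visited before. Space is the number of cells visited on the work, random access and relation query tapes. An \emph{accepting path} of $M$ on $(x,k)$ is a word $y\in\{0,1\}^*$ such that $M$ with $y$ on the choice tape halts in an accepting state having visited exactly the cells of $y$; $\#\mathrm{acc}_M(x,k)$ is the number of accepting paths. All bounds below are required for all inputs $(x,k)$ and all contents of the choice tape. \begin{itemize} \item $M$ is a \emph{para-$\mathrm L$-machine} if there is a computable $f\colon\mathbb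 N\to\mathbb N$ such that $M$ uses space $O(\log(|x|+f(k)))$ and halts within a number of steps polynomial in $|x|+f(k)$. \item $M$ is \emph{$k$-bounded} if there is a computable $f$ such that $M$ visits at most $f(k)\cdot\log|x|$ bits of the choice tape. \item $M$ has \emph{read-once access} to its nondeterministic bits if the head of the choice tape never moves to the left. \item $M$ is \emph{tail-nondeterministic} if there is a computable $g$ such that $M$ makes at most $g(k)\cdot\log|x|$ further steps after its first nondeterministic step. \end{itemize} \textbf{Classes.} $\#\mathrm{para}_W\text{-}\mathrm L$ is the class of parameterised functions $F$ for which there is a $k$-bounded para-$\mathrm L$-machine $M$ with $\#\mathrm{acc}_M(x,k)=F(x,k)$ for all $(x,k)$. $\#\mathrm{para}_\beta\text{-}\mathrm L$, $\#\mathrm{para}_{W\text{-tail}}\text{-}\mathrm L$ and $\#\mathrm{para}_{\beta\text{-tail}}\text{-}\mathrm L$ are defined in the same way, where $M$ has in addition read-once access to its nondeterministic bits, is tail-nondeterministic, or both, respectively. \textbf{Theorem.} Let $\mathcal C$ be any of the four classes $\#\mathrm{para}_W\text{-}\mathrm L$, $\#\mathrm{para}_{W\text{-tail}}\text{-}\mathrm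 L$, $\#\mathrm{para}_\beta\text{-}\mathrm L$, $\#\mathrm{para}_{\beta\text{-tail}}\text{-}\mathrm L$. If $F,G\in\mathcal C$, then $F+G\in\mathcal C$ and $F\cdot G\in\mathcal C$. -/

import Mathlib

namespace ParaLog

/-- The logarithm used in resource bounds: the rounded-up binary logarithm, never below one. -/
def lg (n : ℕ) : ℕ := max 1 (Nat.clog 2 n)

/-- A parameterised function `F : {0,1}* × ℕ → ℕ`; the second argument is the parameter. -/
abbrev ParamFun : Type := List Bool → ℕ → ℕ

/-- The relations of the structure that an input word is read as: `R x i t` says whether the tuple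
`t` belongs to the `i`-th relation of the structure given by `x`. For plain word inputs there are
no relations, i.e. `R` is constantly `false`. -/
abbrev InputRelations : Type := List Bool → ℕ → List ℕ → Bool

/-! ### Tapes -/

/-- Tape symbols: left end marker, blank, separator, the bits `0` and `1`, and the machine's
own additional symbols. -/
inductive Sym (A : Type) : Type
  | leftEnd : Sym A
  | blank : Sym A
  | sep : Sym A
  | bit : Bool → Sym A
  | extra : A → Sym A

/-- Head movements. -/
inductive Move : Type
  | left : Move
  | stay : Move
  | right : Move

/-- A one-sided infinite tape: the contents of the cells visited so far (an initial segment of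
the tape, cell `0` holding the left end marker; all other cells are blank) and the head position. -/
structure Tape (A : Type) : Type where
  cells : List (Sym A)
  pos : ℕ

/-- The empty tape with the head on the left end marker. -/
def Tape.empty {A : Type} : Tape A := ⟨[Sym.leftEnd], 0⟩

/-- The scanned symbol. -/
def Tape.read {A : Type} (T : Tape A) : Sym A := T.cells.getD T.pos Sym.blank

/-- Overwrite the scanned cell; the left end marker in cell `0` cannot be overwritten. -/
def Tape.write {A : Type} (a : Sym A) (T : Tape A) : Tape A :=
  if T.pos = 0 then T else ⟨T.cells.set T.pos a, T.pos⟩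

/-- Move the head; at the left end a move to the left has no effect. A cell entered for the first
time is blank and is recorded as visited. -/
def Tape.move {A : Type} (m : Move) (T : Tape A) : Tape A :=
  match m with
  | Move.left => ⟨T.cells, T.pos - 1⟩
  | Move.stay => T
  | Move.right =>
      ⟨if T.pos + 1 < T.cells.length then T.cells else T.cells ++ [Sym.blank], T.pos + 1⟩

/-- The number encoded by a list of bits, least significant bit first. -/
def bitsVal (l : List Bool) : ℕ := l.foldr Nat.bit 0

/-- The longest block of bits at the beginning of a list of symbols. -/
def bitBlock {A : Type} : List (Sym A) → List Bool
  | Sym.bit b :: l => b :: bitBlock l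
  | _ => []

/-- The numbers written at the beginning of a list of symbols: blocks of bits separated by `sep`,
up to the first symbol that is neither a bit nor `sep`. -/
def numBlocks {A : Type} : List (Sym A) → List Bool → List ℕ
  | Sym.bit b :: l, acc => numBlocks l (acc ++ [b])
  | Sym.sep :: l, acc => bitsVal acc :: numBlocks l []
  | _, acc => [bitsVal acc]

/-- The input position whose index is written on the random access tape. -/
def Tape.address {A : Type} (T : Tape A) : ℕ := bitsVal (bitBlock T.cells.tail)

/-- The answer to the query on the relation query tape, where the first number is the relation
identifier and the remaining numbers form the tuple. -/
def Tape.answer {A : Type} (T : Tape A) (rel : ℕ → List ℕ → Bool) : Bool :=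
  match numBlocks T.cells.tail [] with
  | [] => false
  | i :: t => rel i t

/-! ### Machines -/

/-- The tapes of a machine whose work tapes are indexed by `W`. -/
inductive TapeIx (W : Type) : Type
  | addr : TapeIx W
  | query : TapeIx W
  | work : W → TapeIx W

/-- What a machine does in one step: the new state, the symbol written and the head movement on
each tape, and the head movement on the (read-only) choice tape. -/
structure Action (Q A W : Type) : Type where
  state : Q
  write : TapeIx W → Sym A
  move : TapeIx W → Move
  choiceMove : Move

/-- A Turing machine with random access to its input and with a choice tape. A transition depends
on the state, the scanned tape symbols, the input letter at the position written on the random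
access tape (`none` beyond the end of the input, `some none` for the separator between `x` and
`k`), the answer to the query on the relation query tape, and the scanned bit of the choice tape
(`none` at its left end). The machine halts when `δ` is undefined (`none`). -/
structure Machine : Type 1 where
  State : Type
  Extra : Type
  Work : Type
  [finState : Finite State]
  [finExtra : Finite Extra]
  [finWork : Fintype Work]
  start : State
  accept : State → Bool
  δ : State → (TapeIx Work → Sym Extra) → Option (Option Bool) → Bool → Option Bool →
    Option (Action State Extra Work)

attribute [instance] Machine.finState Machine.finExtra Machine.finWork

/-- Configurations. The choice tape has a left end marker at position `0`, followed by the bits at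
positions `1, 2, …`; `visited` is the number of bit cells of the choice tape visited so far. -/
structure Cfg (M : Machine) : Type where
  state : M.State
  tapes : TapeIx M.Work → Tape M.Extra
  choicePos : ℕ
  visited : ℕ

/-- The input word `x # bin(k)` of the parameterised input `(x, k)`. -/
def inputWord (x : List Bool) (k : ℕ) : List (Option Bool) :=
  x.map some ++ none :: (Nat.bits k).map some

/-- New position of the choice head. -/
def moveChoice (m : Move) (p : ℕ) : ℕ :=
  match m with
  | Move.left => p - 1
  | Move.stay => p
  | Move.right => p + 1

/-- The scanned symbol of a choice tape holding the bits `y 0, y 1, …`. -/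
def choiceRead (y : ℕ → Bool) : ℕ → Option Bool
  | 0 => none
  | p + 1 => some (y p)

namespace Machine

variable (M : Machine) (R : InputRelations) (x : List Bool) (k : ℕ)

/-- The initial configuration. -/
def startCfg : Cfg M := ⟨M.start, fun _ => Tape.empty, 0, 0⟩

/-- The action in configuration `c` on input `(x, k)` with choice tape content `y`. -/
def action (y : ℕ → Bool) (c : Cfg M) : Option (Action M.State M.Extra M.Work) :=
  M.δ c.state (fun i => (c.tapes i).read)
    ((inputWord x k)[(c.tapes TapeIx.addr).address]?)
    ((c.tapes TapeIx.query).answer (R x))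
    (choiceRead y c.choicePos)

/-- One step; `none` if the machine halts. A step is nondeterministic iff it increases
`visited`. -/
def step (y : ℕ → Bool) (c : Cfg M) : Option (Cfg M) :=
  (M.action R x k y c).map fun a =>
    { state := a.state
      tapes := fun i => ((c.tapes i).write (a.write i)).move (a.move i)
      choicePos := moveChoice a.choiceMove c.choicePos
      visited := max c.visited (moveChoice a.choiceMove c.choicePos) }

/-- The configuration after `t` steps (after halting, the configuration does not change). -/
def cfgAt (y : ℕ → Bool) (t : ℕ) : Cfg M :=
  (fun c => (M.step R x k y c).getD c)^[t] M.startCfg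

/-- The machine has halted after at most `t` steps. -/
def HaltedAt (y : ℕ → Bool) (t : ℕ) : Prop := M.step R x k y (M.cfgAt R x k y t) = none

/-- The number of visited cells on all tapes except the (read-only) input and choice tapes. -/
def space {M : Machine} (c : Cfg M) : ℕ :=
  (c.tapes TapeIx.addr).cells.length + (c.tapes TapeIx.query).cells.length +
    ∑ i : M.Work, (c.tapes (TapeIx.work i)).cells.length

/-- The word `y` describes an accepting computation path: with `y` on the choice tape the machine
halts in an accepting state, and `y` consists of exactly the choice bits that it visited. -/
def IsAcceptingPath (y : List Bool) : Prop :=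
  ∃ t, M.HaltedAt R x k (fun i => y.getD i false) t ∧
    M.accept (M.cfgAt R x k (fun i => y.getD i false) t).state = true ∧
    (M.cfgAt R x k (fun i => y.getD i false) t).visited = y.length

/-- The number of accepting paths on input `(x, k)`. -/
noncomputable def acc : ℕ∞ := {y : List Bool | M.IsAcceptingPath R x k y}.encard

/-- `M` is a para-L-machine: for some computable `f`, on all inputs and all contents of the choice
tape, its space is `O(log (|x| + f k))` and its time is polynomial in `|x| + f k`. -/
def IsParaL : Prop :=
  ∃ (c d : ℕ) (f : ℕ → ℕ), Computable f ∧ ∀ (x : List Bool) (k : ℕ) (y : ℕ → Bool),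
    (∀ t, space (M.cfgAt R x k y t) ≤ c * lg (x.length + f k)) ∧
    M.HaltedAt R x k y (c * (x.length + f k) ^ d)

/-- `M` is `k`-bounded: it reads at most `f k * log |x|` bits from the choice tape. -/
def IsKBounded : Prop :=
  ∃ f : ℕ → ℕ, Computable f ∧ ∀ (x : List Bool) (k : ℕ) (y : ℕ → Bool) (t : ℕ),
    (M.cfgAt R x k y t).visited ≤ f k * lg x.length

/-- `M` is tail-nondeterministic: after its first nondeterministic step it makes at most
`g k * log |x|` further steps. -/
def IsTail : Prop :=
  ∃ g : ℕ → ℕ, Computable g ∧ ∀ (x : List Bool) (k : ℕ) (y : ℕ → Bool) (t : ℕ),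
    0 < (M.cfgAt R x k y t).visited → M.HaltedAt R x k y (t + g k * lg x.length)

/-- Read-once access to the nondeterministic bits: the choice head never moves to the left. -/
def IsReadOnce : Prop :=
  ∀ q s i r b a, M.δ q s i r b = some a → a.choiceMove ≠ Move.left

/-- `M` computes `F` by its number of accepting paths. -/
def Counts (F : ParamFun) : Prop := ∀ (x : List Bool) (k : ℕ), M.acc R x k = (F x k : ℕ∞)

end Machine

/-! ### The counting classes -/

/-- The class `#para_W-L`. -/
def SharpParaWL (R : InputRelations) : Set ParamFun :=
  {F | ∃ M : Machine, M.IsParaL R ∧ M.IsKBounded R ∧ M.Counts R F}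

/-- The class `#para_β-L`. -/
def SharpParaBetaL (R : InputRelations) : Set ParamFun :=
  {F | ∃ M : Machine, M.IsParaL R ∧ M.IsKBounded R ∧ M.IsReadOnce ∧ M.Counts R F}

/-- The class `#para_W-tail-L`. -/
def SharpParaWTailL (R : InputRelations) : Set ParamFun :=
  {F | ∃ M : Machine, M.IsParaL R ∧ M.IsKBounded R ∧ M.IsTail R ∧ M.Counts R F}

/-- The class `#para_β-tail-L`. -/
def SharpParaBetaTailL (R : InputRelations) : Set ParamFun :=
  {F | ∃ M : Machine, M.IsParaL R ∧ M.IsKBounded R ∧ M.IsReadOnce ∧ M.IsTail R ∧ M.Counts R F}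

/-- Closure under pointwise addition and pointwise multiplication of parameterised functions. -/
def ClosedUnderAddMul (C : Set ParamFun) : Prop :=
  ∀ F ∈ C, ∀ G ∈ C, (fun x k => F x k + G x k) ∈ C ∧ (fun x k => F x k * G x k) ∈ C

end ParaLog

/-!
The sum and the product of two functions counted by machines `M false` and `M true` are both counted
by one combined machine `comb prod M`. Its choice tape carries a code of a choice of one machine and
an accepting path of it (sum), or of an accepting path of each machine (product), and the combined
machine accepts exactly the code words. Three points need care.

*Tail-nondeterminism.* The deterministic phases of both machines have to be over before the first
choice bit is read. So both machines are first simulated up to their first nondeterministic steps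
(`Comb.reaches_suspend`), which do not depend on the choice tape. As there is only one random
access tape and one relation query tape, every tape of either machine has a mirror among the work
tapes, on which the simulation reads; the two special tapes always carry a second copy of those of
the machine that is being simulated. Passing from one machine to the other amounts to copying two
mirrors (`Comb.reaches_load`). This takes time linear in the space bound `O(log (|x| + f k))`, which
is at most a function of `k` times `log |x|` (`lg_add_le_mul`), so it may be done even after the first
nondeterministic step.

*Finding the ends of a path.* The machine cannot remember positions on the choice tape, so these are
marked on the tape. A path `y` of length `v` is represented by `v + 1` blocks of three bits. Block `0`
holds a bit that selects a machine, and block `j > 0` holds the bit `j` of `y`; the second bit of a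
block marks block `0`, where the simulated choice tape has its left end, and the third bit marks the
last block, beyond which the simulated head must not go. The marked last block must have been visited
when the simulated machine accepts. Thus the code of a path is unique, its blocks are exactly those
that are visited, and the end of the first path of a product can be found (`Comb.sim_run`,
`Comb.sim_finish`, `Comb.reaches_skip`).

*Read-once access.* The choice head moves to the left only in order to simulate such a move. If both
machines have read-once access, these moves are disabled in the transition function.

The resulting description of the accepting runs is `Comb.comb_run`. The number of code words is
determined in `Comb.encard_outcome_sum` and `Comb.encard_outcome_mul`.
-/

namespace ParaLog

/-! ### Tapes -/

theorem moveChoice_le (m : Move) (p : ℕ) : moveChoice m p ≤ p + 1 := by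
  cases m <;> simp [moveChoice]; omega

namespace Tape

variable {A B : Type}

/-- The symbol in cell `j`; cells that were not visited are blank. -/
def val (T : Tape A) (j : ℕ) : Sym A := T.cells.getD j Sym.blank

theorem read_eq (T : Tape A) : T.read = T.val T.pos := rfl

@[simp] theorem pos_write (T : Tape A) (a : Sym A) : (T.write a).pos = T.pos := by
  unfold write; split <;> rfl

@[simp] theorem length_write (T : Tape A) (a : Sym A) :
    (T.write a).cells.length = T.cells.length := by
  unfold write; split <;> simp

@[simp] theorem pos_move (T : Tape A) (m : Move) : (T.move m).pos = moveChoice m T.pos := by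
  cases m <;> rfl

theorem val_write {T : Tape A} (h : T.pos < T.cells.length) (a : Sym A) (j : ℕ) :
    (T.write a).val j = if j = T.pos ∧ T.pos ≠ 0 then a else T.val j := by
  unfold write val
  by_cases h0 : T.pos = 0
  · simp [h0]
  · by_cases hj : j = T.pos
    · subst hj
      simp [h0, List.getD_eq_getElem?_getD, h]
    · simp [h0, hj, List.getD_eq_getElem?_getD, List.getElem?_set_ne (Ne.symm hj)]

@[simp] theorem val_move (T : Tape A) (m : Move) (j : ℕ) : (T.move m).val j = T.val j := by
  cases m with
  | left => rfl
  | stay => rfl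
  | right =>
    unfold move val
    by_cases h : T.pos + 1 < T.cells.length
    · simp [h]
    · simp only [h, if_false, List.getD_eq_getElem?_getD, List.getElem?_append]
      split
      · rfl
      · rename_i hj
        rw [List.getElem?_eq_none (Nat.le_of_not_lt hj)]
        rcases j - T.cells.length with _ | n <;> simp

theorem length_move {T : Tape A} (h : T.pos < T.cells.length) (m : Move) :
    (T.move m).cells.length = max T.cells.length ((T.move m).pos + 1) := by
  cases m with
  | left => simp [move]; omega
  | stay => simp [move]; omega
  | right =>
    simp only [move]
    split <;> (simp; omega)

theorem pos_lt_length_move {T : Tape A} (h : T.pos < T.cells.length) (m : Move) :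
    (T.move m).pos < (T.move m).cells.length := by
  rw [length_move h]; omega

@[simp] theorem write_read (T : Tape A) : T.write T.read = T := by
  unfold write read
  split
  · rfl
  · cases T with
    | mk c p =>
      congr 1
      apply List.ext_getElem?
      intro j
      by_cases hj : p = j
      · subst hj
        by_cases hp : p < c.length
        · simp [hp]
        · rw [List.set_eq_of_length_le (Nat.le_of_not_lt hp)]
      · simp [List.getElem?_set_ne hj]

@[simp] theorem move_stay (T : Tape A) : T.move Move.stay = T := rfl

theorem length_le_length_move (T : Tape A) (m : Move) :
    T.cells.length ≤ (T.move m).cells.length := by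
  cases m with
  | left => exact le_rfl
  | stay => exact le_rfl
  | right => simp only [move]; split <;> simp

theorem val_empty (j : ℕ) : (Tape.empty : Tape A).val j = if j = 0 then Sym.leftEnd else Sym.blank := by
  rcases j with _ | j <;> simp [Tape.empty, val]

/-- The tape has its head on cell `p`, its contents are given by `f`, and at most the cells
`0, …, S` have been visited. -/
structure Holds (S : ℕ) (T : Tape A) (f : ℕ → Sym A) (p : ℕ) : Prop where
  pos : T.pos = p
  val : ∀ j, T.val j = f j
  wf : T.pos < T.cells.length
  len : T.cells.length ≤ S + 1

theorem Holds.read {S : ℕ} {T : Tape A} {f : ℕ → Sym A} {p : ℕ} (h : Holds S T f p) :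
    T.read = f p := by rw [read_eq, h.val, h.pos]

theorem Holds.write_move {S : ℕ} {T : Tape A} {f g : ℕ → Sym A} {p q : ℕ} (h : Holds S T f p)
    {a : Sym A} {m : Move} (hq : moveChoice m p = q) (hS : q ≤ S)
    (hg : ∀ j, g j = if j = p ∧ p ≠ 0 then a else f j) :
    Holds S ((T.write a).move m) g q := by
  have hw : (T.write a).pos < (T.write a).cells.length := by simpa using h.wf
  have hp : ((T.write a).move m).pos = q := by simp [h.pos, hq]
  refine ⟨hp, fun j => ?_, pos_lt_length_move hw m, ?_⟩
  · rw [val_move, val_write h.wf, hg, h.pos, h.val]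
  · rw [length_move hw, hp]
    have := h.len
    simp; omega

theorem Holds.move {S : ℕ} {T : Tape A} {f : ℕ → Sym A} {p q : ℕ} (h : Holds S T f p)
    {m : Move} (hq : moveChoice m p = q) (hS : q ≤ S) :
    Holds S ((T.write T.read).move m) f q := by
  refine h.write_move hq hS fun j => ?_
  rw [h.read]
  split
  · rename_i h1; rw [h1.1]
  · rfl

/-- The shape of the tapes of the combined machine: the symbol `leftEnd` occurs in cell `0` only, and
the cells that do not hold a blank form an initial segment of length at most `S`. Hence a machine
can find both ends of what is written on the tape. -/
structure Good (S : ℕ) (T : Tape A) : Prop where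
  wf : T.pos < T.cells.length
  len : T.cells.length ≤ S + 1
  left : ∀ j, T.val j = Sym.leftEnd ↔ j = 0
  dense : ∃ L ≤ S, T.pos ≤ L ∧ ∀ j, T.val j = Sym.blank ↔ L ≤ j

theorem Good.holds {S : ℕ} {T : Tape A} (h : Good S T) : Holds S T T.val T.pos :=
  ⟨rfl, fun _ => rfl, h.wf, h.len⟩

theorem Holds.good {S : ℕ} {T : Tape A} {f : ℕ → Sym A} {p : ℕ} (h : Holds S T f p)
    (left : ∀ j, f j = Sym.leftEnd ↔ j = 0)
    (dense : ∃ L ≤ S, p ≤ L ∧ ∀ j, f j = Sym.blank ↔ L ≤ j) : Good S T := by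
  have hv : T.val = f := funext h.val
  refine ⟨h.wf, h.len, ?_, ?_⟩
  · rw [hv]; exact left
  · rw [hv, h.pos]; exact dense

theorem good_empty {S : ℕ} (hS : 0 < S) : Good S (Tape.empty : Tape A) := by
  refine ⟨by simp [Tape.empty], by simp [Tape.empty], fun j => ?_, 1, hS, by simp [Tape.empty],
    fun j => ?_⟩
  · rw [val_empty]; split <;> simp_all
  · rw [val_empty]; split <;> simp_all; omega

theorem Good.write_move {S : ℕ} {T : Tape A} (h : Good S T) {a : Sym A} (hb : a ≠ Sym.blank)
    (hl : a ≠ Sym.leftEnd) {m : Move} (hp : T.pos < S) (hq : moveChoice m T.pos < S) :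
    Good S ((T.write a).move m) := by
  obtain ⟨L, hL, hpL, hd⟩ := h.dense
  have hH := h.holds.write_move (a := a) (m := m) rfl hq.le (fun _ => rfl)
  have hL0 : L ≠ 0 := by
    rintro rfl
    have h1 := (hd 0).2 le_rfl
    rw [(h.left 0).2 rfl] at h1
    cases h1
  refine hH.good (fun j => ?_) ⟨max L (T.pos + 1), by omega, ?_, fun j => ?_⟩
  · split
    · rename_i h1; simp [hl]; omega
    · exact h.left j
  · have := moveChoice_le m T.pos
    omega
  · split
    · rename_i h1; simp [hb]; omega
    · rename_i h1
      rw [hd]; omega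

/-- `s'` represents the symbol `s` under the encoding `enc`. The left end marker and the blanks of
cells that were never written represent themselves. -/
def Codes (enc : Sym B → Sym A) (s' : Sym A) (s : Sym B) : Prop :=
  s' = enc s ∨ (s' = Sym.leftEnd ∧ s = Sym.leftEnd) ∨ (s' = Sym.blank ∧ s = Sym.blank)

/-- The tape `T'` represents the tape `T` cell by cell, with the head on the same cell. -/
structure Mirrors (enc : Sym B → Sym A) (T' : Tape A) (T : Tape B) : Prop where
  pos : T'.pos = T.pos
  val : ∀ j, Codes enc (T'.val j) (T.val j)

theorem mirrors_empty (enc : Sym B → Sym A) : Mirrors enc Tape.empty Tape.empty := by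
  refine ⟨rfl, fun j => ?_⟩
  rw [val_empty, val_empty]
  split <;> simp [Codes]

theorem Mirrors.write_move {enc : Sym B → Sym A} {T' : Tape A} {T : Tape B}
    (h : Mirrors enc T' T) (hT' : T'.pos < T'.cells.length) (hT : T.pos < T.cells.length)
    (a : Sym B) (m : Move) : Mirrors enc ((T'.write (enc a)).move m) ((T.write a).move m) := by
  refine ⟨by simp [h.pos], fun j => ?_⟩
  rw [val_move, val_move, val_write hT', val_write hT, h.pos]
  split
  · exact Or.inl rfl
  · exact h.val j

/-- An encoding of symbols that keeps bits and separators and sends no other symbol to a bit or a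
separator. -/
structure Faithful (enc : Sym B → Sym A) : Prop where
  bit : ∀ s b, enc s = Sym.bit b ↔ s = Sym.bit b
  sep : ∀ s, enc s = Sym.sep ↔ s = Sym.sep

theorem Codes.bit_iff {enc : Sym B → Sym A} (he : Faithful enc) {s' : Sym A} {s : Sym B}
    (h : Codes enc s' s) (b : Bool) : s' = Sym.bit b ↔ s = Sym.bit b := by
  rcases h with rfl | ⟨rfl, rfl⟩ | ⟨rfl, rfl⟩
  · exact he.bit s b
  · simp
  · simp

theorem Codes.sep_iff {enc : Sym B → Sym A} (he : Faithful enc) {s' : Sym A} {s : Sym B}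
    (h : Codes enc s' s) : s' = Sym.sep ↔ s = Sym.sep := by
  rcases h with rfl | ⟨rfl, rfl⟩ | ⟨rfl, rfl⟩
  · exact he.sep s
  · simp
  · simp

theorem bitBlock_eq_nil {l : List (Sym A)} (h : ∀ b, l.getD 0 Sym.blank ≠ Sym.bit b) :
    bitBlock l = [] := by
  rcases l with _ | ⟨s, l⟩
  · rfl
  · cases s <;> simp_all [bitBlock]

theorem bitBlock_congr {enc : Sym B → Sym A} (he : Faithful enc) (l : List (Sym A))
    (l' : List (Sym B))
    (h : ∀ j, Codes enc (l.getD j Sym.blank) (l'.getD j Sym.blank)) :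
    bitBlock l = bitBlock l' := by
  induction l generalizing l' with
  | nil =>
    refine (bitBlock_eq_nil fun b hb => ?_).symm
    have := ((h 0).bit_iff he b).2 hb
    simp at this
  | cons s l ih =>
    by_cases hs : ∃ b, s = Sym.bit b
    · obtain ⟨b, rfl⟩ := hs
      have h0 := ((h 0).bit_iff he b).1 (by simp)
      rcases l' with _ | ⟨s', l'⟩
      · simp at h0
      · simp at h0
        subst h0
        simp only [bitBlock]
        rw [ih l' fun j => by simpa using h (j + 1)]
    · rw [bitBlock_eq_nil, bitBlock_eq_nil]
      · intro b hb
        exact hs ⟨b, by simpa using ((h 0).bit_iff he b).2 hb⟩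
      · intro b hb
        exact hs ⟨b, by simpa using hb⟩

theorem numBlocks_eq_singleton {l : List (Sym A)} (h : ∀ b, l.getD 0 Sym.blank ≠ Sym.bit b)
    (h' : l.getD 0 Sym.blank ≠ Sym.sep) (acc : List Bool) : numBlocks l acc = [bitsVal acc] := by
  rcases l with _ | ⟨s, l⟩
  · rfl
  · cases s <;> simp_all [numBlocks]

theorem numBlocks_congr {enc : Sym B → Sym A} (he : Faithful enc) (l : List (Sym A))
    (l' : List (Sym B)) (h : ∀ j, Codes enc (l.getD j Sym.blank) (l'.getD j Sym.blank))
    (acc : List Bool) : numBlocks l acc = numBlocks l' acc := by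
  induction l generalizing l' acc with
  | nil =>
    refine (numBlocks_eq_singleton (fun b hb => ?_) (fun hb => ?_) acc).symm
    · have := ((h 0).bit_iff he b).2 hb
      simp at this
    · have := ((h 0).sep_iff he).2 hb
      simp at this
  | cons s l ih =>
    by_cases hs : ∃ b, s = Sym.bit b
    · obtain ⟨b, rfl⟩ := hs
      have h0 := ((h 0).bit_iff he b).1 (by simp)
      rcases l' with _ | ⟨s', l'⟩
      · simp at h0
      · simp at h0
        subst h0
        simp only [numBlocks]
        rw [ih l' fun j => by simpa using h (j + 1)]
    · by_cases hs' : s = Sym.sep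
      · subst hs'
        have h0 := ((h 0).sep_iff he).1 (by simp)
        rcases l' with _ | ⟨s', l'⟩
        · simp at h0
        · simp at h0
          subst h0
          simp only [numBlocks]
          rw [ih l' fun j => by simpa using h (j + 1)]
      · rw [numBlocks_eq_singleton, numBlocks_eq_singleton]
        · intro b hb
          exact hs ⟨b, by simpa using ((h 0).bit_iff he b).2 hb⟩
        · intro hb
          exact hs' (by simpa using ((h 0).sep_iff he).2 hb)
        · intro b hb
          exact hs ⟨b, by simpa using hb⟩
        · simpa using hs'

theorem Mirrors.tail {enc : Sym B → Sym A} {T' : Tape A} {T : Tape B} (h : Mirrors enc T' T)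
    (j : ℕ) : Codes enc (T'.cells.tail.getD j Sym.blank) (T.cells.tail.getD j Sym.blank) := by
  simpa [Tape.val, List.getD_eq_getElem?_getD] using h.val (j + 1)

theorem Mirrors.address {enc : Sym B → Sym A} (he : Faithful enc) {T' : Tape A} {T : Tape B}
    (h : Mirrors enc T' T) : T'.address = T.address := by
  unfold Tape.address
  rw [bitBlock_congr he _ _ h.tail]

theorem Mirrors.answer {enc : Sym B → Sym A} (he : Faithful enc) {T' : Tape A} {T : Tape B}
    (h : Mirrors enc T' T) (rel : ℕ → List ℕ → Bool) : T'.answer rel = T.answer rel := by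
  unfold Tape.answer
  rw [numBlocks_congr he _ _ h.tail]

end Tape

/-! ### Runs of machines -/

namespace Machine

variable {M : Machine} {R : InputRelations} {x : List Bool} {k : ℕ} {y y' : ℕ → Bool}

variable (M R x k y) in
/-- The successor configuration; a halted configuration is its own successor. -/
def next (c : Cfg M) : Cfg M := (M.step R x k y c).getD c

theorem next_of_step {c c' : Cfg M} (h : M.step R x k y c = some c') :
    M.next R x k y c = c' := by simp [next, h]

theorem next_of_halted {c : Cfg M} (h : M.step R x k y c = none) :
    M.next R x k y c = c := by simp [next, h]

theorem cfgAt_succ (t : ℕ) :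
    M.cfgAt R x k y (t + 1) = M.next R x k y (M.cfgAt R x k y t) :=
  Function.iterate_succ_apply' _ _ _

theorem iterate_of_halted {c : Cfg M} (h : M.step R x k y c = none) (n : ℕ) :
    (M.next R x k y)^[n] c = c :=
  Function.iterate_fixed (next_of_halted h) n

theorem cfgAt_add (s t : ℕ) :
    M.cfgAt R x k y (s + t) = (M.next R x k y)^[t] (M.cfgAt R x k y s) := by
  rw [add_comm]; exact Function.iterate_add_apply _ _ _ _

theorem cfgAt_of_haltedAt {s t : ℕ} (h : M.HaltedAt R x k y s) (hst : s ≤ t) :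
    M.cfgAt R x k y t = M.cfgAt R x k y s := by
  obtain ⟨d, rfl⟩ := Nat.exists_eq_add_of_le hst
  rw [cfgAt_add, iterate_of_halted h]

theorem HaltedAt.mono {s t : ℕ} (h : M.HaltedAt R x k y s) (hst : s ≤ t) :
    M.HaltedAt R x k y t := by
  unfold HaltedAt
  rw [cfgAt_of_haltedAt h hst]
  exact h

theorem HaltedAt.cfgAt_eq {s t : ℕ} (hs : M.HaltedAt R x k y s) (ht : M.HaltedAt R x k y t) :
    M.cfgAt R x k y s = M.cfgAt R x k y t := by
  rcases le_total s t with h | h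
  · exact (cfgAt_of_haltedAt hs h).symm
  · exact cfgAt_of_haltedAt ht h

/-- A reflexive relation that holds across every step holds between a configuration and its
successor, also if the machine has halted. -/
theorem next_induction {P : Cfg M → Cfg M → Prop} (hr : ∀ c, P c c)
    (hs : ∀ c c', M.step R x k y c = some c' → P c c') (c : Cfg M) : P c (M.next R x k y c) := by
  rcases h : M.step R x k y c with _ | c'
  · rw [next_of_halted h]; exact hr c
  · rw [next_of_step h]; exact hs c c' h

theorem visited_le_next (c : Cfg M) : c.visited ≤ (M.next R x k y c).visited := by
  refine next_induction (P := fun c c' => c.visited ≤ c'.visited) (fun _ => le_rfl) ?_ c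
  intro c c' h
  obtain ⟨a, -, rfl⟩ := Option.map_eq_some_iff.1 h
  exact le_max_left _ _

theorem visited_mono {s t : ℕ} (h : s ≤ t) :
    (M.cfgAt R x k y s).visited ≤ (M.cfgAt R x k y t).visited := by
  induction t, h using Nat.le_induction with
  | base => exact le_rfl
  | succ t _ ih => rw [cfgAt_succ]; exact ih.trans (visited_le_next _)

theorem length_le_next (c : Cfg M) (i : TapeIx M.Work) :
    (c.tapes i).cells.length ≤ ((M.next R x k y c).tapes i).cells.length := by
  refine next_induction
    (P := fun c c' => (c.tapes i).cells.length ≤ (c'.tapes i).cells.length) (fun _ => le_rfl) ?_ c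
  intro c c' h
  obtain ⟨a, -, rfl⟩ := Option.map_eq_some_iff.1 h
  exact (Tape.length_write _ _).symm.trans_le (Tape.length_le_length_move _ _)

theorem length_mono {s t : ℕ} (h : s ≤ t) (i : TapeIx M.Work) :
    ((M.cfgAt R x k y s).tapes i).cells.length ≤ ((M.cfgAt R x k y t).tapes i).cells.length := by
  induction t, h using Nat.le_induction with
  | base => exact le_rfl
  | succ t _ ih => rw [cfgAt_succ]; exact ih.trans (length_le_next _ i)

theorem choicePos_le_visited (t : ℕ) :
    (M.cfgAt R x k y t).choicePos ≤ (M.cfgAt R x k y t).visited := by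
  induction t with
  | zero => exact le_rfl
  | succ t ih =>
    rw [cfgAt_succ]
    rcases h : M.step R x k y (M.cfgAt R x k y t) with _ | c'
    · rw [next_of_halted h]; exact ih
    · rw [next_of_step h]
      obtain ⟨a, -, rfl⟩ := Option.map_eq_some_iff.1 h
      exact le_max_right _ _

theorem pos_lt_length (t : ℕ) (i : TapeIx M.Work) :
    ((M.cfgAt R x k y t).tapes i).pos < ((M.cfgAt R x k y t).tapes i).cells.length := by
  induction t with
  | zero => simp [cfgAt, startCfg, Tape.empty]
  | succ t ih =>
    rw [cfgAt_succ]
    rcases h : M.step R x k y (M.cfgAt R x k y t) with _ | c'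
    · rw [next_of_halted h]; exact ih
    · rw [next_of_step h]
      obtain ⟨a, -, rfl⟩ := Option.map_eq_some_iff.1 h
      exact Tape.pos_lt_length_move (by simpa using ih) _

theorem length_le_space (c : Cfg M) (i : TapeIx M.Work) :
    (c.tapes i).cells.length ≤ space c := by
  unfold space
  cases i with
  | addr => omega
  | query => omega
  | work w =>
    have := Finset.single_le_sum (f := fun i : M.Work => (c.tapes (TapeIx.work i)).cells.length)
      (fun _ _ => Nat.zero_le _) (Finset.mem_univ w)
    omega

theorem space_le (c : Cfg M) (B : ℕ) (h : ∀ i, (c.tapes i).cells.length ≤ B) :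
    space c ≤ (Fintype.card M.Work + 2) * B := by
  unfold space
  have := Finset.sum_le_card_nsmul Finset.univ
    (fun i : M.Work => (c.tapes (TapeIx.work i)).cells.length) B (fun i _ => h _)
  have h1 := h TapeIx.addr
  have h2 := h TapeIx.query
  simp only [smul_eq_mul, Finset.card_univ] at this
  linarith

/-- A step depends on the choice tape through the scanned symbol only. -/
theorem step_congr {c : Cfg M} (h : choiceRead y c.choicePos = choiceRead y' c.choicePos) :
    M.step R x k y c = M.step R x k y' c := by
  unfold step action; rw [h]

theorem choiceRead_congr {p v : ℕ} (h : ∀ j < v, y j = y' j) (hp : p ≤ v) :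
    choiceRead y p = choiceRead y' p := by
  cases p with
  | zero => rfl
  | succ p => simp [choiceRead, h p hp]

/-- A run depends on the choice bits that it visits only. -/
theorem cfgAt_congr {t : ℕ} (h : ∀ j < (M.cfgAt R x k y t).visited, y j = y' j) :
    M.cfgAt R x k y' t = M.cfgAt R x k y t := by
  induction t with
  | zero => rfl
  | succ t ih =>
    have h' : ∀ j < (M.cfgAt R x k y t).visited, y j = y' j := fun j hj =>
      h j (hj.trans_le (visited_mono (Nat.le_succ t)))
    rw [cfgAt_succ, cfgAt_succ, ih h']
    unfold next
    rw [step_congr (choiceRead_congr h' (choicePos_le_visited t))]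

theorem haltedAt_congr {t : ℕ} (h : ∀ j < (M.cfgAt R x k y t).visited, y j = y' j) :
    M.HaltedAt R x k y' t ↔ M.HaltedAt R x k y t := by
  unfold HaltedAt
  rw [cfgAt_congr h, step_congr (choiceRead_congr h (choicePos_le_visited t))]

variable (R x k y) in
/-- `c'` is the configuration after at most `N` steps from `c`. -/
def Reaches (N : ℕ) (c c' : Cfg M) : Prop := ∃ n ≤ N, (M.next R x k y)^[n] c = c'

theorem Reaches.refl (N : ℕ) (c : Cfg M) : Reaches R x k y N c c := ⟨0, Nat.zero_le _, rfl⟩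

theorem Reaches.mono {N N' : ℕ} {c c' : Cfg M} (h : Reaches R x k y N c c') (hN : N ≤ N') :
    Reaches R x k y N' c c' := by
  obtain ⟨n, hn, h⟩ := h
  exact ⟨n, hn.trans hN, h⟩

theorem Reaches.trans {N N' : ℕ} {c c' c'' : Cfg M} (h : Reaches R x k y N c c')
    (h' : Reaches R x k y N' c' c'') : Reaches R x k y (N + N') c c'' := by
  obtain ⟨n, hn, rfl⟩ := h
  obtain ⟨n', hn', rfl⟩ := h'
  exact ⟨n' + n, by omega, Function.iterate_add_apply _ _ _ _⟩

theorem Reaches.head {N : ℕ} {c c' c'' : Cfg M} (h : M.step R x k y c = some c')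
    (h' : Reaches R x k y N c' c'') : Reaches R x k y (N + 1) c c'' := by
  obtain ⟨n, hn, rfl⟩ := h'
  exact ⟨n + 1, by omega, by rw [Function.iterate_succ_apply, next_of_step h]⟩

theorem Reaches.cfgAt {N s : ℕ} {c : Cfg M} (h : Reaches R x k y N (M.cfgAt R x k y s) c) :
    ∃ t, s ≤ t ∧ t ≤ s + N ∧ M.cfgAt R x k y t = c := by
  obtain ⟨n, hn, rfl⟩ := h
  exact ⟨s + n, by omega, by omega, cfgAt_add s n⟩

end Machine

/-! ### The combined machine -/

/-- One of the two tapes that a machine can query: the random access tape (`false`) or the relation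
query tape (`true`). -/
def TapeIx.special {W : Type} (t : Bool) : TapeIx W := bif t then TapeIx.query else TapeIx.addr

/-- The purpose for which the next block of the choice tape is fetched: it is the header block of a
simulated run (in a product, the header of the run of machine `stage`), it is entered by the
simulated head of machine `i` from the left or from the right, or it is skipped after the run of the
first machine. -/
inductive Fetch : Type
  | header (stage : Bool) : Fetch
  | right (i : Bool) : Fetch
  | left (i : Bool) : Fetch
  | skip : Fetch
  deriving Fintype

/-- The control states of the combined machine. -/
inductive Ctrl : Type
  /-- Machine `i` is simulated up to its first nondeterministic step. -/
  | pre (i : Bool) : Ctrl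
  /-- First phase of loading the special tape `t` of machine `i`: bring the heads to the left end,
  and note the head position of machine `i` on the ruler. The bit `e` is kept for later. -/
  | rewind (i t e : Bool) : Ctrl
  /-- Second phase of loading: copy the mirror tape. -/
  | copy (i t e : Bool) : Ctrl
  /-- Third phase of loading: bring the heads to the left end. -/
  | home (i t e : Bool) : Ctrl
  /-- Last phase of loading: bring the heads to the position noted on the ruler. -/
  | seek (i t e : Bool) : Ctrl
  /-- The choice head has to move `n` cells to the left before a block is fetched. -/
  | back (n : Fin 7) (i seen : Bool) : Ctrl
  /-- A block of the choice tape is going to be read. -/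
  | fetch₀ (κ : Fetch) (seen : Bool) : Ctrl
  /-- The head is on the first bit of the block. -/
  | fetch₁ (κ : Fetch) (seen : Bool) : Ctrl
  /-- The head is on the second bit of the block, the first one being `b`. -/
  | fetch₂ (κ : Fetch) (seen b : Bool) : Ctrl
  /-- The head is on the third bit of the block, the first two being `b` and `m`. -/
  | fetch₃ (κ : Fetch) (seen b m : Bool) : Ctrl
  /-- Machine `i` is simulated beyond its first nondeterministic step: its choice head scans `cur`,
  the end bit of the scanned block is `e`, and `seen` tells whether a block with end bit `true` has
  been visited. -/
  | sim (i : Bool) (cur : Option Bool) (e seen : Bool) : Ctrl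
  /-- The machine has halted. -/
  | halt (accept : Bool) : Ctrl
  deriving Fintype

instance {A : Type} [Finite A] : Finite (Sym A) := by
  refine Finite.of_surjective
    (fun s : Option (Option (Option (Bool ⊕ A))) => match s with
      | none => Sym.leftEnd
      | some none => Sym.blank
      | some (some none) => Sym.sep
      | some (some (some (Sum.inl b))) => Sym.bit b
      | some (some (some (Sum.inr a))) => Sym.extra a) fun s => ?_
  cases s with
  | leftEnd => exact ⟨none, rfl⟩
  | blank => exact ⟨some none, rfl⟩
  | sep => exact ⟨some (some none), rfl⟩
  | bit b => exact ⟨some (some (some (Sum.inl b))), rfl⟩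
  | extra a => exact ⟨some (some (some (Sum.inr a))), rfl⟩

instance {W : Type} [Finite W] : Finite (TapeIx W) := by
  refine Finite.of_surjective
    (fun s : Option (Option W) => match s with
      | none => TapeIx.addr
      | some none => TapeIx.query
      | some (some w) => TapeIx.work w) fun s => ?_
  cases s with
  | addr => exact ⟨none, rfl⟩
  | query => exact ⟨some none, rfl⟩
  | work w => exact ⟨some (some w), rfl⟩

namespace Comb

variable (M : Bool → Machine)

/-- States: a state of each of the two machines and a control state. -/
abbrev State : Type := (∀ j, (M j).State) × Ctrl

/-- An additional symbol represents a symbol of each of the two machines. -/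
abbrev Extra : Type := ∀ j, Sym (M j).Extra

/-- The work tapes: a mirror of every tape of each of the two machines, and a ruler (`none`). -/
abbrev Work : Type := Option (Σ i : Bool, TapeIx (M i).Work)

/-- The mirror of the tape `τ` of machine `i`. -/
abbrev mirror (i : Bool) (τ : TapeIx (M i).Work) : TapeIx (Work M) := TapeIx.work (some ⟨i, τ⟩)

/-- A tape whose head position is used as a counter. -/
abbrev ruler : TapeIx (Work M) := TapeIx.work none

variable {M}

/-- The representation of the symbols of machine `i`. It keeps bits and separators, and its values
differ from the blank and from the left end marker. -/
def encSym (i : Bool) : Sym (M i).Extra → Sym (Extra M)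
  | Sym.bit b => Sym.bit b
  | Sym.sep => Sym.sep
  | s => Sym.extra (Function.update (fun _ => Sym.blank) i s)

/-- The symbol of machine `i` that a symbol represents. -/
def decSym (i : Bool) : Sym (Extra M) → Sym (M i).Extra
  | Sym.leftEnd => Sym.leftEnd
  | Sym.blank => Sym.blank
  | Sym.sep => Sym.sep
  | Sym.bit b => Sym.bit b
  | Sym.extra g => g i

theorem decSym_encSym (i : Bool) (s : Sym (M i).Extra) : decSym i (encSym i s) = s := by
  cases s <;> simp [encSym, decSym]

theorem encSym_ne_blank (i : Bool) (s : Sym (M i).Extra) : encSym i s ≠ Sym.blank := by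
  cases s <;> simp [encSym]

theorem encSym_ne_leftEnd (i : Bool) (s : Sym (M i).Extra) : encSym i s ≠ Sym.leftEnd := by
  cases s <;> simp [encSym]

theorem encSym_faithful (i : Bool) : Tape.Faithful (encSym (M := M) i) := by
  constructor
  · intro s b; cases s <;> simp [encSym]
  · intro s; cases s <;> simp [encSym]

theorem decSym_of_codes {i : Bool} {s' : Sym (Extra M)} {s : Sym (M i).Extra}
    (h : Tape.Codes (encSym i) s' s) : decSym i s' = s := by
  rcases h with rfl | ⟨rfl, rfl⟩ | ⟨rfl, rfl⟩
  · exact decSym_encSym i s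
  · rfl
  · rfl

/-- The tape contents do not change, and the choice head moves as given. -/
def idle (q : ∀ j, (M j).State) (c : Ctrl) (s : TapeIx (Work M) → Sym (Extra M)) (m : Move) :
    Action (State M) (Extra M) (Work M) :=
  ⟨(q, c), s, fun _ => Move.stay, m⟩

/-- Perform the action `a` of machine `i` on the special tapes and on the mirrors of machine `i`;
the choice head does not move. -/
def simulate (i : Bool) (a : Action (M i).State (M i).Extra (M i).Work) (q : ∀ j, (M j).State)
    (c : Ctrl) (s : TapeIx (Work M) → Sym (Extra M)) : Action (State M) (Extra M) (Work M) where
  state := (Function.update q i a.state, c)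
  write := fun τ => match τ with
    | TapeIx.addr => encSym i (a.write TapeIx.addr)
    | TapeIx.query => encSym i (a.write TapeIx.query)
    | TapeIx.work none => s (TapeIx.work none)
    | TapeIx.work (some ⟨j, τ⟩) =>
      match Function.update (fun j => (none : Option (Action (M j).State (M j).Extra (M j).Work)))
        i (some a) j with
      | some a' => encSym j (a'.write τ)
      | none => s (TapeIx.work (some ⟨j, τ⟩))
  move := fun τ => match τ with
    | TapeIx.addr => a.move TapeIx.addr
    | TapeIx.query => a.move TapeIx.query
    | TapeIx.work none => Move.stay
    | TapeIx.work (some ⟨j, τ⟩) =>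
      match Function.update (fun j => (none : Option (Action (M j).State (M j).Extra (M j).Work)))
        i (some a) j with
      | some a' => a'.move τ
      | none => Move.stay
  choiceMove := Move.stay

open Classical in
/-- The action on a special tape `t` (write `wr`, move by `mr`), on its mirror for machine `i` (write
`wm`, move by `mm`) and on the ruler (move by `mρ`) in the course of loading. -/
noncomputable def loadStep (i t : Bool) (q : ∀ j, (M j).State) (c : Ctrl) (s : TapeIx (Work M) → Sym (Extra M))
    (wr wm : Sym (Extra M)) (mr mm mρ : Move) : Action (State M) (Extra M) (Work M) where
  state := (q, c)
  write := fun τ => if τ = TapeIx.special t then wr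
    else if τ = mirror M i (TapeIx.special t) then wm else s τ
  move := fun τ => if τ = TapeIx.special t then mr
    else if τ = mirror M i (TapeIx.special t) then mm
    else if τ = ruler M then mρ else Move.stay
  choiceMove := Move.stay

/-- What follows when machine `i` is about to make its first nondeterministic step or has halted
before: the other machine gets its turn, or the nondeterministic part begins. -/
def suspend (i : Bool) : Ctrl :=
  if i then Ctrl.rewind false false false else Ctrl.fetch₀ (Fetch.header false) false

/-- What follows when the special tape `t` of machine `i` has been loaded. -/
def loaded (i t e : Bool) : Ctrl :=
  if t then (if i then Ctrl.sim true none e e else Ctrl.pre false) else Ctrl.rewind i true e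

/-- What follows when the block with selection bit `b`, start bit `m` and end bit `e` has been read.
Here and below `prod` tells whether the product (or else the sum) is computed. -/
def dispatch (prod : Bool) (κ : Fetch) (seen b m e : Bool) : Ctrl :=
  match κ with
  | Fetch.header stage =>
    if m && (!prod || b == stage) then
      (if b then Ctrl.rewind true false e else Ctrl.sim false none e e)
    else Ctrl.halt false
  | Fetch.right i => if m then Ctrl.halt false else Ctrl.sim i (some b) e (seen || e)
  | Fetch.left i => Ctrl.sim i (if m then none else some b) e seen
  | Fetch.skip =>
    if e then Ctrl.fetch₀ (Fetch.header true) false else Ctrl.fetch₀ Fetch.skip false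

/-- What follows when the simulated machine `i` has halted, successfully or not. -/
def finish (prod i ok e : Bool) : Ctrl :=
  if ok then
    if prod && !i then
      (if e then Ctrl.fetch₀ (Fetch.header true) false else Ctrl.fetch₀ Fetch.skip false)
    else Ctrl.halt true
  else Ctrl.halt false

open Classical in
variable (M) in
/-- The move to the left, which is disabled if both machines have read-once access. -/
noncomputable def leftMove : Move := if ∀ i, (M i).IsReadOnce then Move.stay else Move.left

open Classical in
/-- The transition function of the combined machine. -/
noncomputable def δ (prod : Bool) (qc : State M) (s : TapeIx (Work M) → Sym (Extra M))
    (inp : Option (Option Bool)) (ans : Bool) (ch : Option Bool) :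
    Option (Action (State M) (Extra M) (Work M)) :=
  let q := qc.1
  match qc.2 with
  | Ctrl.pre i =>
    match (M i).δ (q i) (fun τ => decSym i (s (mirror M i τ))) inp ans none with
    | none => some (idle q (suspend i) s Move.stay)
    | some a =>
      match a.choiceMove with
      | Move.right => some (idle q (suspend i) s Move.stay)
      | _ => some (simulate i a q (Ctrl.pre i) s)
  | Ctrl.rewind i t e =>
    let r := s (TapeIx.special t)
    let m := s (mirror M i (TapeIx.special t))
    if r = Sym.leftEnd ∧ m = Sym.leftEnd then some (idle q (Ctrl.copy i t e) s Move.stay)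
    else some (loadStep i t q (Ctrl.rewind i t e) s r m Move.left Move.left
      (if m = Sym.leftEnd then Move.stay else Move.right))
  | Ctrl.copy i t e =>
    let r := s (TapeIx.special t)
    let m := s (mirror M i (TapeIx.special t))
    if m = Sym.blank ∧ r = Sym.blank then some (idle q (Ctrl.home i t e) s Move.stay)
    else
      let a := if m = Sym.blank then encSym i Sym.blank else m
      some (loadStep i t q (Ctrl.copy i t e) s a a Move.right Move.right Move.stay)
  | Ctrl.home i t e =>
    let r := s (TapeIx.special t)
    let m := s (mirror M i (TapeIx.special t))
    if m = Sym.leftEnd then some (idle q (Ctrl.seek i t e) s Move.stay)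
    else some (loadStep i t q (Ctrl.home i t e) s r m Move.left Move.left Move.stay)
  | Ctrl.seek i t e =>
    let r := s (TapeIx.special t)
    let m := s (mirror M i (TapeIx.special t))
    if s (ruler M) = Sym.leftEnd then some (idle q (loaded i t e) s Move.stay)
    else some (loadStep i t q (Ctrl.seek i t e) s r m Move.right Move.right Move.left)
  | Ctrl.back ⟨0, _⟩ i seen => some (idle q (Ctrl.fetch₀ (Fetch.left i) seen) s Move.stay)
  | Ctrl.back ⟨n + 1, h⟩ i seen =>
    some (idle q (Ctrl.back ⟨n, Nat.lt_of_succ_lt h⟩ i seen) s (leftMove M))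
  | Ctrl.fetch₀ κ seen => some (idle q (Ctrl.fetch₁ κ seen) s Move.right)
  | Ctrl.fetch₁ κ seen => some (idle q (Ctrl.fetch₂ κ seen (ch.getD false)) s Move.right)
  | Ctrl.fetch₂ κ seen b => some (idle q (Ctrl.fetch₃ κ seen b (ch.getD false)) s Move.right)
  | Ctrl.fetch₃ κ seen b m =>
    some (idle q (dispatch prod κ seen b m (ch.getD false)) s Move.stay)
  | Ctrl.sim i cur e seen =>
    match (M i).δ (q i) (fun τ => decSym i (s (mirror M i τ))) inp ans cur with
    | none => some (idle q (finish prod i ((M i).accept (q i) && seen) e) s Move.stay)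
    | some a =>
      match a.choiceMove with
      | Move.stay => some (simulate i a q (Ctrl.sim i cur e seen) s)
      | Move.right =>
        if e then some (idle q (Ctrl.halt false) s Move.stay)
        else some (simulate i a q (Ctrl.fetch₀ (Fetch.right i) seen) s)
      | Move.left =>
        match cur with
        | none => some (simulate i a q (Ctrl.sim i none e seen) s)
        | some _ => some (simulate i a q (Ctrl.back 6 i seen) s)
  | Ctrl.halt _ => none

end Comb

/-- The combined machine for the sum (`prod = false`) or the product (`prod = true`) of the
functions computed by two machines. -/
@[reducible] noncomputable def comb (prod : Bool) (M : Bool → Machine) : Machine where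
  State := Comb.State M
  Extra := Comb.Extra M
  Work := Comb.Work M
  finWork := Fintype.ofFinite _
  start := (fun j => (M j).start, Ctrl.pre true)
  accept := fun qc => match qc.2 with
    | Ctrl.halt b => b
    | _ => false
  δ := Comb.δ prod

theorem comb_isReadOnce (prod : Bool) (M : Bool → Machine) (h : ∀ i, (M i).IsReadOnce) :
    (comb prod M).IsReadOnce := by
  intro q s inp ans ch a ha
  obtain ⟨q, c⟩ := q
  have hl : Comb.leftMove M ≠ Move.left := by simp [Comb.leftMove, h]
  simp only [Comb.δ] at ha
  split at ha <;> (try split at ha) <;> (try split at ha) <;> (try split at ha) <;>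
    simp only [Option.some.injEq, reduceCtorEq] at ha <;> subst ha <;>
    simp [Comb.idle, Comb.simulate, Comb.loadStep, hl]

/-! ### Loading the special tapes of a machine -/

namespace Comb

open Machine

variable {prod : Bool} {M : Bool → Machine} {R : InputRelations} {x : List Bool} {k : ℕ}
  {Y : ℕ → Bool}

variable (prod) in
/-- A configuration of the combined machine, given by its components. -/
abbrev conf (q : ∀ j, (M j).State) (c : Ctrl) (tp : TapeIx (Work M) → Tape (Extra M)) (h v : ℕ) :
    Cfg (comb prod M) := ⟨(q, c), tp, h, v⟩

variable {q : ∀ j, (M j).State} {c c' : Ctrl} {tp tp₀ : TapeIx (Work M) → Tape (Extra M)} {h v : ℕ}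

theorem step_idle {m : Move} (ha : (comb prod M).action R x k Y (conf prod q c tp h v) =
      some (idle q c' (fun τ => (tp τ).read) m)) :
    (comb prod M).step R x k Y (conf prod q c tp h v) =
      some (conf prod q c' tp (moveChoice m h) (max v (moveChoice m h))) := by
  unfold step
  rw [ha]
  simp [idle]

theorem reaches_idle {m : Move} (ha : (comb prod M).action R x k Y (conf prod q c tp h v) =
      some (idle q c' (fun τ => (tp τ).read) m)) :
    Reaches R x k Y 1 (conf prod q c tp h v)
      (conf prod q c' tp (moveChoice m h) (max v (moveChoice m h))) :=
  Reaches.head (step_idle ha) (Reaches.refl 0 _)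

theorem reaches_idle_stay (hv : h ≤ v)
    (ha : (comb prod M).action R x k Y (conf prod q c tp h v) =
      some (idle q c' (fun τ => (tp τ).read) Move.stay)) :
    Reaches R x k Y 1 (conf prod q c tp h v) (conf prod q c' tp h v) := by
  have := reaches_idle ha
  simpa [moveChoice, hv] using this

/-- The three tapes that are used when the special tape `t` of machine `i` is loaded are described
by their contents `fr`, `fm` and head positions `pr`, `pm`, `pρ`. The ruler is never written on, and
all other tapes are as in `tp₀`. -/
structure Loading (S : ℕ) (i t : Bool) (tp₀ tp : TapeIx (Work M) → Tape (Extra M))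
    (fr fm : ℕ → Sym (Extra M)) (pr pm pρ : ℕ) : Prop where
  real : Tape.Holds S (tp (TapeIx.special t)) fr pr
  mirror : Tape.Holds S (tp (mirror M i (TapeIx.special t))) fm pm
  ruler : Tape.Holds S (tp (ruler M)) (Tape.empty : Tape (Extra M)).val pρ
  frame : ∀ τ, τ ≠ TapeIx.special t → τ ≠ Comb.mirror M i (TapeIx.special t) → τ ≠ Comb.ruler M →
    tp τ = tp₀ τ

theorem special_ne_work {W : Type} (t : Bool) (w : W) : TapeIx.special t ≠ TapeIx.work w := by
  cases t <;> simp [TapeIx.special]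

variable {S : ℕ} {i t : Bool} {fr fm : ℕ → Sym (Extra M)} {pr pm pρ : ℕ}

theorem Loading.step (hL : Loading S i t tp₀ tp fr fm pr pm pρ) (hv : h ≤ v)
    {wr wm : Sym (Extra M)} {mr mm mρ : Move}
    (ha : (comb prod M).action R x k Y (conf prod q c tp h v) =
      some (loadStep i t q c' (fun τ => (tp τ).read) wr wm mr mm mρ))
    {gr gm : ℕ → Sym (Extra M)} {pr' pm' pρ' : ℕ}
    (hr : moveChoice mr pr = pr') (hm : moveChoice mm pm = pm') (hρ : moveChoice mρ pρ = pρ')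
    (hr' : pr' ≤ S) (hm' : pm' ≤ S) (hρ' : pρ' ≤ S)
    (hgr : ∀ j, gr j = if j = pr ∧ pr ≠ 0 then wr else fr j)
    (hgm : ∀ j, gm j = if j = pm ∧ pm ≠ 0 then wm else fm j) :
    ∃ tp', (comb prod M).step R x k Y (conf prod q c tp h v) = some (conf prod q c' tp' h v) ∧
      Loading S i t tp₀ tp' gr gm pr' pm' pρ' := by
  refine ⟨_, by unfold Machine.step; rw [ha]; simp [loadStep, moveChoice, hv]; rfl, ?_, ?_, ?_, ?_⟩
  · simpa [loadStep] using hL.real.write_move (a := wr) hr hr' hgr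
  · simpa [loadStep, (special_ne_work _ _).symm] using hL.mirror.write_move (a := wm) hm hm' hgm
  · simpa [loadStep, (special_ne_work _ _).symm] using hL.ruler.move hρ hρ'
  · intro τ h1 h2 h3
    rw [← hL.frame τ h1 h2 h3]
    simp [h1, h2, h3]

theorem Loading.keep (f : ℕ → Sym (Extra M)) (p j : ℕ) :
    f j = if j = p ∧ p ≠ 0 then f p else f j := by
  split
  · rename_i h1; rw [h1.1]
  · rfl

/-- The number of steps that the mirror head takes to the left end is added to the ruler. -/
theorem reaches_rewind {e : Bool} (hv : h ≤ v) (hr : ∀ j, fr j = Sym.leftEnd ↔ j = 0)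
    (hm : ∀ j, fm j = Sym.leftEnd ↔ j = 0) (N : ℕ) :
    ∀ {tp pr pm pρ}, Loading S i t tp₀ tp fr fm pr pm pρ → pr ≤ N → pm ≤ N → pρ + pm ≤ S →
    ∃ tp', Reaches R x k Y (N + 1) (conf prod q (Ctrl.rewind i t e) tp h v)
        (conf prod q (Ctrl.copy i t e) tp' h v) ∧ Loading S i t tp₀ tp' fr fm 0 0 (pρ + pm) := by
  induction N with
  | zero =>
    intro tp pr pm pρ hL h1 h2 h3
    obtain rfl : pr = 0 := by omega
    obtain rfl : pm = 0 := by omega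
    refine ⟨tp, reaches_idle_stay hv ?_, hL⟩
    simp [action, δ, hL.real.read, hL.mirror.read, (hr 0).2, (hm 0).2]
  | succ N ih =>
    intro tp pr pm pρ hL h1 h2 h3
    by_cases h0 : pr = 0 ∧ pm = 0
    · obtain ⟨rfl, rfl⟩ := h0
      refine ⟨tp, (reaches_idle_stay hv ?_).mono (by omega), hL⟩
      simp [action, δ, hL.real.read, hL.mirror.read, (hr 0).2, (hm 0).2]
    · have hwr := hL.real.wf
      have hlr := hL.real.len
      have hwm := hL.mirror.wf
      have hlm := hL.mirror.len
      rw [hL.real.pos] at hwr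
      rw [hL.mirror.pos] at hwm
      obtain ⟨tp', hs, hL'⟩ := hL.step (prod := prod) (R := R) (x := x) (k := k) (Y := Y) (q := q)
        (c := Ctrl.rewind i t e) (c' := Ctrl.rewind i t e) (h := h) (v := v)
        (wr := fr pr) (wm := fm pm) (mr := Move.left) (mm := Move.left)
        (mρ := if pm = 0 then Move.stay else Move.right) (pρ' := pρ + (pm - (pm - 1))) hv
        (by simp [action, δ, hL.real.read, hL.mirror.read, hr, hm, h0]) rfl rfl
        (by split <;> simp [moveChoice] <;> omega)
        (by simp [moveChoice]; omega) (by simp [moveChoice]; omega) (by omega)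
        (Loading.keep _ _)
        (Loading.keep _ _)
      simp only [moveChoice] at hL'
      obtain ⟨tp'', hs', hL''⟩ := ih hL' (by omega) (by omega) (by omega)
      refine ⟨tp'', Reaches.head hs hs', ?_⟩
      have : pρ + (pm - (pm - 1)) + (pm - 1) = pρ + pm := by omega
      rwa [this] at hL''

open Classical in
/-- When the heads are on cell `p`, the two tapes agree below `p`; `L` is the number of cells in which
at least one of them is not blank. A blank of the mirror tape below `L` is overwritten by the code of a
blank, so that afterwards the blanks mark the end of the contents again. -/
theorem reaches_copy {e : Bool} (hv : h ≤ v) {L : ℕ} (hLS : L ≤ S) (N : ℕ) :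
    ∀ {tp fr fm p}, Loading S i t tp₀ tp fr fm p p pρ → L - p ≤ N → p ≤ L →
    (∀ j, fr j = Sym.leftEnd ↔ j = 0) → (∀ j, fm j = Sym.leftEnd ↔ j = 0) →
    (∀ j < p, fr j = fm j) → (∀ j, (fm j = Sym.blank ∧ fr j = Sym.blank) ↔ L ≤ j) →
    ∃ tp' f, Reaches R x k Y (N + 1) (conf prod q (Ctrl.copy i t e) tp h v)
        (conf prod q (Ctrl.home i t e) tp' h v) ∧ Loading S i t tp₀ tp' f f L L pρ ∧
      (∀ j, f j = Sym.leftEnd ↔ j = 0) ∧ (∀ j, f j = Sym.blank ↔ L ≤ j) ∧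
      ∀ j, f j = fm j ∨ (f j = encSym i Sym.blank ∧ fm j = Sym.blank) := by
  -- copying ends when the heads are on cell `L`
  have key : ∀ {tp fr fm p} (N : ℕ), Loading S i t tp₀ tp fr fm p p pρ → p = L →
      (∀ j, fm j = Sym.leftEnd ↔ j = 0) →
      (∀ j < p, fr j = fm j) → (∀ j, (fm j = Sym.blank ∧ fr j = Sym.blank) ↔ L ≤ j) →
      ∃ tp' f, Reaches R x k Y (N + 1) (conf prod q (Ctrl.copy i t e) tp h v)
        (conf prod q (Ctrl.home i t e) tp' h v) ∧ Loading S i t tp₀ tp' f f L L pρ ∧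
      (∀ j, f j = Sym.leftEnd ↔ j = 0) ∧ (∀ j, f j = Sym.blank ↔ L ≤ j) ∧
      ∀ j, f j = fm j ∨ (f j = encSym i Sym.blank ∧ fm j = Sym.blank) := by
    rintro tp fr fm p N hL rfl hm heq hb
    have hfr : fr = fm := by
      funext j
      rcases lt_or_ge j p with hj | hj
      · exact heq j hj
      · obtain ⟨h1, h2⟩ := (hb j).2 hj
        rw [h1, h2]
    subst hfr
    refine ⟨tp, fr, (reaches_idle_stay hv ?_).mono (by omega), hL, hm, fun j => by
      simpa using hb j, fun j => Or.inl rfl⟩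
    have := (hb p).2 le_rfl
    simp [action, δ, hL.real.read, hL.mirror.read, this]
  induction N with
  | zero =>
    intro tp fr fm p hL h1 h2 hr hm heq hb
    exact key 0 hL (by omega) hm heq hb
  | succ N ih =>
    intro tp fr fm p hL h1 h2 hr hm heq hb
    rcases h2.eq_or_lt with hpL | hpL
    · exact key _ hL hpL hm heq hb
    · have hnb : ¬ (fm p = Sym.blank ∧ fr p = Sym.blank) := by rw [hb]; omega
      set a := if fm p = Sym.blank then encSym i Sym.blank else fm p with ha
      have hab : a ≠ Sym.blank := by
        rw [ha]; split
        · exact encSym_ne_blank _ _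
        · assumption
      have hal : a = Sym.leftEnd ↔ p = 0 := by
        rw [ha]; split
        · rename_i h3
          simp only [encSym_ne_leftEnd, false_iff]
          rintro rfl
          rw [(hm 0).2 rfl] at h3
          cases h3
        · exact hm p
      obtain ⟨tp', hs, hL'⟩ := hL.step (prod := prod) (R := R) (x := x) (k := k) (Y := Y) (q := q)
        (c := Ctrl.copy i t e) (c' := Ctrl.copy i t e) (h := h) (v := v)
        (wr := a) (wm := a) (mr := Move.right) (mm := Move.right) (mρ := Move.stay) hv
        (by simp only [action, δ, hL.real.read, hL.mirror.read, hnb, if_false, ha]) rfl rfl rfl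
        (by simp only [moveChoice]; omega) (by simp only [moveChoice]; omega)
        (by have := hL.ruler.wf; have := hL.ruler.len; rw [hL.ruler.pos] at *
            simp only [moveChoice]; omega)
        (fun _ => rfl) (fun _ => rfl)
      simp only [moveChoice] at hL'
      obtain ⟨tp'', f, hs', hL'', hf1, hf2, hf3⟩ := ih hL' (by omega) (by omega)
        (fun j => by
          split
          · rename_i h3; rw [hal]; omega
          · exact hr j)
        (fun j => by
          split
          · rename_i h3; rw [hal]; omega
          · exact hm j)
        (fun j hj => by
          split
          · rfl
          · rename_i h3
            rcases Nat.lt_succ_iff_lt_or_eq.1 hj with h4 | h4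
            · exact heq j h4
            · have : j = 0 := by omega
              rw [(hr j).2 this, (hm j).2 this])
        (fun j => by
          split
          · rename_i h3; simp only [hab, false_and, false_iff]; omega
          · exact hb j)
      refine ⟨tp'', f, Reaches.head hs hs', hL'', hf1, hf2, fun j => ?_⟩
      have hj := hf3 j
      split at hj
      · rename_i h3
        rcases hj with hj | hj
        · rw [h3.1, ← h3.1, hj, h3.1, ha]
          split
          · rename_i h4; exact Or.inr ⟨rfl, h4⟩
          · exact Or.inl rfl
        · exact absurd hj.2 hab
      · exact hj

theorem reaches_home {e : Bool} {f : ℕ → Sym (Extra M)} (hv : h ≤ v)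
    (hf : ∀ j, f j = Sym.leftEnd ↔ j = 0) (p : ℕ) :
    ∀ {tp}, Loading S i t tp₀ tp f f p p pρ →
    ∃ tp', Reaches R x k Y (p + 1) (conf prod q (Ctrl.home i t e) tp h v)
        (conf prod q (Ctrl.seek i t e) tp' h v) ∧ Loading S i t tp₀ tp' f f 0 0 pρ := by
  induction p with
  | zero =>
    intro tp hL
    refine ⟨tp, reaches_idle_stay hv ?_, hL⟩
    simp [action, δ, hL.mirror.read, hf]
  | succ p ih =>
    intro tp hL
    have hwm := hL.mirror.wf
    have hlm := hL.mirror.len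
    rw [hL.mirror.pos] at hwm
    obtain ⟨tp', hs, hL'⟩ := hL.step (prod := prod) (R := R) (x := x) (k := k) (Y := Y) (q := q)
        (c := Ctrl.home i t e) (c' := Ctrl.home i t e) (h := h) (v := v)
        (wr := f (p + 1)) (wm := f (p + 1)) (mr := Move.left) (mm := Move.left) (mρ := Move.stay) hv
        (by simp [action, δ, hL.real.read, hL.mirror.read, hf]) rfl rfl rfl
        (by simp only [moveChoice]; omega) (by simp only [moveChoice]; omega)
        (by have := hL.ruler.wf; have := hL.ruler.len; rw [hL.ruler.pos] at *
            simp only [moveChoice]; omega)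
        (Loading.keep _ _)
        (Loading.keep _ _)
    simp only [moveChoice] at hL'
    obtain ⟨tp'', hs', hL''⟩ := ih hL'
    exact ⟨tp'', Reaches.head hs hs', hL''⟩

theorem reaches_seek {e : Bool} {f : ℕ → Sym (Extra M)} (hv : h ≤ v) (n : ℕ) :
    ∀ {tp p}, Loading S i t tp₀ tp f f p p n → p + n ≤ S →
    ∃ tp', Reaches R x k Y (n + 1) (conf prod q (Ctrl.seek i t e) tp h v)
        (conf prod q (loaded i t e) tp' h v) ∧
      Loading S i t tp₀ tp' f f (p + n) (p + n) 0 := by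
  induction n with
  | zero =>
    intro tp p hL hp
    refine ⟨tp, reaches_idle_stay hv ?_, hL⟩
    simp [action, δ, hL.ruler.read, Tape.val_empty]
  | succ n ih =>
    intro tp p hL hp
    obtain ⟨tp', hs, hL'⟩ := hL.step (prod := prod) (R := R) (x := x) (k := k) (Y := Y) (q := q)
        (c := Ctrl.seek i t e) (c' := Ctrl.seek i t e) (h := h) (v := v)
        (wr := f p) (wm := f p) (mr := Move.right) (mm := Move.right) (mρ := Move.left) hv
        (by simp [action, δ, hL.real.read, hL.mirror.read, hL.ruler.read, Tape.val_empty]) rfl rfl rfl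
        (by simp only [moveChoice]; omega) (by simp only [moveChoice]; omega)
        (by simp only [moveChoice]; omega)
        (Loading.keep _ _)
        (Loading.keep _ _)
    simp only [moveChoice] at hL'
    obtain ⟨tp'', hs', hL''⟩ := ih hL' (by omega)
    refine ⟨tp'', Reaches.head hs hs', ?_⟩
    rw [show p + 1 + n = p + (n + 1) by omega] at hL''
    exact hL''

/-- The tapes of the combined machine represent the tapes `ct j` of the machines `j`: all tapes are
of the right shape, the ruler is reset, and the mirrors are up to date. -/
structure Inv (S : ℕ) (tp : TapeIx (Work M) → Tape (Extra M))
    (ct : ∀ j, TapeIx (M j).Work → Tape (M j).Extra) : Prop where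
  good : ∀ τ, τ ≠ ruler M → (tp τ).Good S
  ruler : Tape.Holds S (tp (ruler M)) (Tape.empty : Tape (Extra M)).val 0
  mirror : ∀ j τ, (tp (mirror M j τ)).Mirrors (encSym j) (ct j τ)

/-- The special tape `t` holds the contents of the corresponding tape of machine `i`. -/
def Active (tp : TapeIx (Work M) → Tape (Extra M))
    (ct : ∀ j, TapeIx (M j).Work → Tape (M j).Extra) (i t : Bool) : Prop :=
  (tp (TapeIx.special t)).Mirrors (encSym i) (ct i (TapeIx.special t))

/-- Replacing blanks by codes of blanks does not change what a tape represents. -/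
theorem Loading.codes {f : ℕ → Sym (Extra M)} {T' : Tape (Extra M)} {T : Tape (M i).Extra}
    (hm : T'.Mirrors (encSym i) T)
    (hf : ∀ j, f j = T'.val j ∨ (f j = encSym i Sym.blank ∧ T'.val j = Sym.blank)) (j : ℕ) :
    Tape.Codes (encSym i) (f j) (T.val j) := by
  rcases hf j with h1 | ⟨h1, h2⟩
  · rw [h1]; exact hm.val j
  · have := hm.val j
    rw [h2] at this
    rcases this with h3 | ⟨h3, -⟩ | ⟨-, h3⟩
    · exact absurd h3.symm (encSym_ne_blank _ _)
    · cases h3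
    · rw [h1, h3]; exact Or.inl rfl

/-- One special tape of machine `i` can be loaded in linear time. -/
theorem reaches_loaded {e : Bool} (hv : h ≤ v)
    {ct : ∀ j, TapeIx (M j).Work → Tape (M j).Extra} (hI : Inv S tp ct) :
    ∃ tp', Reaches R x k Y (4 * S + 5) (conf prod q (Ctrl.rewind i t e) tp h v)
        (conf prod q (loaded i t e) tp' h v) ∧ Inv S tp' ct ∧ Active tp' ct i t ∧
        tp' (TapeIx.special !t) = tp (TapeIx.special !t) := by
  have hr := hI.good (TapeIx.special t) (special_ne_work _ _)
  have hm := hI.good (Comb.mirror M i (TapeIx.special t)) (by simp)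
  have hmm := hI.mirror i (TapeIx.special t)
  obtain ⟨Lr, hLr, hpr, hbr⟩ := hr.dense
  obtain ⟨Lm, hLm, hpm, hbm⟩ := hm.dense
  set pm := (tp (Comb.mirror M i (TapeIx.special t))).pos with hpm_def
  have hL₀ : Loading S i t tp tp _ _ _ _ 0 := ⟨hr.holds, hm.holds, hI.ruler, fun _ _ _ _ => rfl⟩
  obtain ⟨tp₁, hs₁, hL₁⟩ := reaches_rewind (prod := prod) (R := R) (x := x) (k := k) (Y := Y)
    (q := q) (e := e) hv hr.left hm.left S hL₀ (by omega) (by omega) (by omega)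
  obtain ⟨tp₂, f, hs₂, hL₂, hf1, hf2, hf3⟩ := reaches_copy (prod := prod) (R := R) (x := x) (k := k)
    (Y := Y) (q := q) (e := e) hv (L := max Lr Lm) (by omega) S hL₁ (by omega) (by omega) hr.left
    hm.left (by omega) (fun j => by rw [hbm, hbr]; omega)
  obtain ⟨tp₃, hs₃, hL₃⟩ := reaches_home (prod := prod) (R := R) (x := x) (k := k) (Y := Y)
    (q := q) (e := e) hv hf1 _ hL₂
  obtain ⟨tp₄, hs₄, hL₄⟩ := reaches_seek (prod := prod) (R := R) (x := x) (k := k) (Y := Y)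
    (q := q) (e := e) hv _ hL₃ (by omega)
  simp only [zero_add] at hL₄
  have hd : ∃ L ≤ S, pm ≤ L ∧ ∀ j, f j = Sym.blank ↔ L ≤ j := ⟨_, by omega, by omega, hf2⟩
  have hc := Loading.codes hmm hf3
  refine ⟨tp₄, (((hs₁.trans hs₂).trans hs₃).trans hs₄).mono (by omega), ⟨?_, hL₄.ruler, ?_⟩, ?_, ?_⟩
  · intro τ hτ
    by_cases h1 : τ = TapeIx.special t
    · subst h1; exact hL₄.real.good hf1 hd
    by_cases h2 : τ = Comb.mirror M i (TapeIx.special t)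
    · subst h2; exact hL₄.mirror.good hf1 hd
    rw [hL₄.frame τ h1 h2 hτ]
    exact hI.good τ hτ
  · intro j τ
    by_cases h2 : Comb.mirror M j τ = Comb.mirror M i (TapeIx.special t)
    · simp only [Comb.mirror, TapeIx.work.injEq, Option.some.injEq, Sigma.mk.injEq] at h2
      obtain ⟨rfl, h3⟩ := h2
      obtain rfl := eq_of_heq h3
      exact ⟨hL₄.mirror.pos.trans hmm.pos, fun j => by rw [hL₄.mirror.val]; exact hc j⟩
    · rw [hL₄.frame _ (special_ne_work _ _).symm h2 (by simp)]
      exact hI.mirror j τ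
  · exact ⟨hL₄.real.pos.trans hmm.pos, fun j => by rw [hL₄.real.val]; exact hc j⟩
  · exact hL₄.frame _ (by cases t <;> simp [TapeIx.special]) (special_ne_work _ _)
      (special_ne_work _ _)

/-- Both special tapes of machine `i` can be loaded in linear time. -/
theorem reaches_load {e : Bool} (hv : h ≤ v)
    {ct : ∀ j, TapeIx (M j).Work → Tape (M j).Extra} (hI : Inv S tp ct) :
    ∃ tp', Reaches R x k Y (8 * S + 10) (conf prod q (Ctrl.rewind i false e) tp h v)
        (conf prod q (if i then Ctrl.sim true none e e else Ctrl.pre false) tp' h v) ∧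
      Inv S tp' ct ∧ ∀ t, Active tp' ct i t := by
  obtain ⟨tp₁, hs₁, hI₁, hA₁, -⟩ := reaches_loaded (prod := prod) (R := R) (x := x) (k := k) (Y := Y)
    (q := q) (i := i) (t := false) (e := e) hv hI
  obtain ⟨tp₂, hs₂, hI₂, hA₂, hf⟩ := reaches_loaded (prod := prod) (R := R) (x := x) (k := k)
    (Y := Y) (q := q) (i := i) (t := true) (e := e) hv hI₁
  refine ⟨tp₂, (hs₁.trans hs₂).mono (by omega), hI₂, fun t => ?_⟩
  cases t with
  | false => unfold Active; rw [show (false : Bool) = !true from rfl, hf]; exact hA₁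
  | true => exact hA₂

end Comb

/-! ### Simulated steps -/

namespace Comb

open Machine

variable {prod : Bool} {M : Bool → Machine} {R : InputRelations} {x : List Bool} {k : ℕ}
  {Y : ℕ → Bool} {q : ∀ j, (M j).State} {c c' : Ctrl} {tp : TapeIx (Work M) → Tape (Extra M)}
  {h v S : ℕ} {i : Bool}

/-- A simulated action of machine `i` keeps the tapes in correspondence. -/
theorem Inv.simulate {ct : ∀ j, TapeIx (M j).Work → Tape (M j).Extra} (hI : Inv S tp ct)
    (hA : ∀ t, Active tp ct i t) (a : Action (M i).State (M i).Extra (M i).Work)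
    (hwf : ∀ τ, (ct i τ).pos < (ct i τ).cells.length) (hp : ∀ τ, (ct i τ).pos < S)
    (hp' : ∀ τ, moveChoice (a.move τ) (ct i τ).pos < S)
    {tp' : TapeIx (Work M) → Tape (Extra M)}
    (htp' : ∀ τ, tp' τ = ((tp τ).write ((simulate i a q c fun τ => (tp τ).read).write τ)).move
      ((simulate i a q c fun τ => (tp τ).read).move τ))
    {ct' : ∀ j, TapeIx (M j).Work → Tape (M j).Extra}
    (hct' : ct' = Function.update ct i fun τ => ((ct i τ).write (a.write τ)).move (a.move τ)) :
    Inv S tp' ct' ∧ ∀ t, Active tp' ct' i t := by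
  subst hct'
  -- a tape of the combined machine that represents a tape of machine `i` keeps doing so
  have key : ∀ (σ : TapeIx (Work M)) (τ : TapeIx (M i).Work), σ ≠ Comb.ruler M →
      (tp σ).Mirrors (encSym i) (ct i τ) →
      tp' σ = ((tp σ).write (encSym i (a.write τ))).move (a.move τ) →
      (tp' σ).Good S ∧
        (tp' σ).Mirrors (encSym i) (((ct i τ).write (a.write τ)).move (a.move τ)) := by
    intro σ τ hσ hm he
    rw [he]
    refine ⟨(hI.good σ hσ).write_move (encSym_ne_blank _ _) (encSym_ne_leftEnd _ _)
      (by rw [hm.pos]; exact hp τ) (by rw [hm.pos]; exact hp' τ),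
      hm.write_move (hI.good σ hσ).wf (hwf τ) _ _⟩
  have haddr := key TapeIx.addr TapeIx.addr (by simp) (hA false) (htp' _)
  have hquery := key TapeIx.query TapeIx.query (by simp) (hA true) (htp' _)
  have hmir := fun τ => key (Comb.mirror M i τ) τ (by simp) (hI.mirror i τ)
    (by rw [htp']; simp [Comb.simulate])
  have hother : ∀ j, j ≠ i → ∀ τ, tp' (Comb.mirror M j τ) = tp (Comb.mirror M j τ) := by
    intro j hj τ
    rw [htp']; simp [Comb.simulate, hj]
  refine ⟨⟨?_, ?_, ?_⟩, ?_⟩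
  · intro τ hτ
    match τ with
    | TapeIx.addr => exact haddr.1
    | TapeIx.query => exact hquery.1
    | TapeIx.work none => exact absurd rfl hτ
    | TapeIx.work (some ⟨j, τ⟩) =>
      by_cases hj : j = i
      · subst hj; exact (hmir τ).1
      · have := hother j hj τ
        unfold Comb.mirror at this
        rw [this]; exact hI.good _ hτ
  · have : tp' (Comb.ruler M) = tp (Comb.ruler M) := by rw [htp']; simp [Comb.simulate]
    rw [this]; exact hI.ruler
  · intro j τ
    by_cases hj : j = i
    · subst hj
      simpa using (hmir τ).2
    · rw [hother j hj, Function.update_of_ne hj]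
      exact hI.mirror j τ
  · intro t
    unfold Active
    cases t with
    | false => simpa [TapeIx.special] using haddr.2
    | true => simpa [TapeIx.special] using hquery.2

/-- The states `q` and the tapes `tp` of the combined machine represent the configurations `cs j` of
the two machines, up to their choice heads. -/
structure Rep (S : ℕ) (cs : ∀ j, Cfg (M j)) (q : ∀ j, (M j).State)
    (tp : TapeIx (Work M) → Tape (Extra M)) : Prop where
  state : ∀ j, q j = (cs j).state
  inv : Inv S tp fun j => (cs j).tapes

/-- In addition, the special tapes hold the contents of those of machine `i`, which therefore can be
simulated. -/
structure RepOn (S : ℕ) (cs : ∀ j, Cfg (M j)) (q : ∀ j, (M j).State)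
    (tp : TapeIx (Work M) → Tape (Extra M)) (i : Bool) : Prop extends Rep S cs q tp where
  active : ∀ t, Active tp (fun j => (cs j).tapes) i t

theorem Rep.length_le {cs : ∀ j, Cfg (M j)} (hR : Rep S cs q tp) (τ : TapeIx (Work M)) :
    (tp τ).cells.length ≤ S + 1 := by
  by_cases hτ : τ = Comb.ruler M
  · subst hτ; exact hR.inv.ruler.len
  · exact (hR.inv.good τ hτ).len

/-- A machine is simulated on the same data as it sees itself. -/
theorem RepOn.delta {cs : ∀ j, Cfg (M j)} (hR : RepOn S cs q tp i) (y : ℕ → Bool) :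
    (M i).δ (q i) (fun τ => decSym i (tp (mirror M i τ)).read)
      ((inputWord x k)[(tp TapeIx.addr).address]?) ((tp TapeIx.query).answer (R x))
      (choiceRead y (cs i).choicePos) = (M i).action R x k y (cs i) := by
  unfold action
  have h1 : (tp TapeIx.addr).address = ((cs i).tapes TapeIx.addr).address :=
    Tape.Mirrors.address (encSym_faithful i) (hR.active false)
  have h2 : (tp TapeIx.query).answer (R x) = ((cs i).tapes TapeIx.query).answer (R x) :=
    Tape.Mirrors.answer (encSym_faithful i) (hR.active true) _
  rw [h1, h2, hR.state i]
  congr 1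
  funext τ
  have := hR.inv.mirror i τ
  rw [Tape.read_eq, Tape.read_eq, this.pos]
  exact decSym_of_codes (this.val _)

/-- Every head of `c` is on a visited cell and below cell `S`. -/
structure Small (S : ℕ) {M : Machine} (c : Cfg M) : Prop where
  wf : ∀ τ, (c.tapes τ).pos < (c.tapes τ).cells.length
  pos : ∀ τ, (c.tapes τ).pos < S

/-- One step of machine `i` is simulated in one step, apart from the movement of the choice head. -/
theorem RepOn.step {cs : ∀ j, Cfg (M j)} (hR : RepOn S cs q tp i) {y : ℕ → Bool}
    {a : Action (M i).State (M i).Extra (M i).Work} {d : Cfg (M i)}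
    (ha : (M i).action R x k y (cs i) = some a) (hd : (M i).step R x k y (cs i) = some d)
    (hs : Small S (cs i)) (hs' : Small S d) (hv : h ≤ v)
    (hc : (comb prod M).action R x k Y (conf prod q c tp h v) =
      some (Comb.simulate i a q c' fun τ => (tp τ).read)) :
    ∃ q' tp', Reaches R x k Y 1 (conf prod q c tp h v) (conf prod q' c' tp' h v) ∧
      RepOn S (Function.update cs i d) q' tp' i := by
  unfold Machine.step at hd
  rw [ha] at hd
  simp only [Option.map_some, Option.some.injEq] at hd
  subst hd
  have hI := hR.inv.simulate (q := q) (c := c') hR.active a hs.wf hs.pos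
    (fun τ => by simpa using hs'.pos τ) (fun _ => rfl) rfl
  have hct : (fun j => ((Function.update cs i
      { state := a.state
        tapes := fun i_1 => (((cs i).tapes i_1).write (a.write i_1)).move (a.move i_1)
        choicePos := moveChoice a.choiceMove (cs i).choicePos
        visited := max (cs i).visited (moveChoice a.choiceMove (cs i).choicePos) }) j).tapes) =
      Function.update (fun j => (cs j).tapes) i
        fun τ => (((cs i).tapes τ).write (a.write τ)).move (a.move τ) := by
    funext j
    by_cases hj : j = i
    · subst hj; simp
    · simp [hj]
  refine ⟨Function.update q i a.state,
    fun τ => ((tp τ).write ((Comb.simulate i a q c' fun τ => (tp τ).read).write τ)).move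
      ((Comb.simulate i a q c' fun τ => (tp τ).read).move τ),
    Reaches.head (N := 0) ?_ (Reaches.refl 0 _), ⟨⟨fun j => ?_, ?_⟩, ?_⟩⟩
  · unfold Machine.step
    rw [hc]
    simp [Comb.simulate, moveChoice, hv]
  · by_cases hj : j = i
    · subst hj; simp
    · simp [hj, hR.state]
  · rw [hct]; exact hI.1
  · rw [hct]; exact hI.2

/-- All configurations of the two machines on the given input are small. -/
def AllSmall (R : InputRelations) (x : List Bool) (k S : ℕ) (M : Bool → Machine) : Prop :=
  ∀ i y t, Small S ((M i).cfgAt R x k y t)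

/-- Machine `i` can be simulated until it is about to make its first nondeterministic step. -/
theorem reaches_suspend (hS : AllSmall R x k S M) {y : ℕ → Bool} {T : ℕ}
    (hT : (M i).HaltedAt R x k y T) (d : ℕ) :
    ∀ {t q tp} {cs : ∀ j, Cfg (M j)}, T ≤ t + d → t ≤ T → cs i = (M i).cfgAt R x k y t →
      (cs i).visited = 0 → RepOn S cs q tp i →
    ∃ t₀ q' tp', Reaches R x k Y (d + 1) (conf prod q (Ctrl.pre i) tp 0 0)
        (conf prod q' (suspend i) tp' 0 0) ∧
      RepOn S (Function.update cs i ((M i).cfgAt R x k y t₀)) q' tp' i ∧ t₀ ≤ T ∧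
      ((M i).cfgAt R x k y t₀).visited = 0 ∧
      ((M i).HaltedAt R x k y t₀ ∨ 0 < ((M i).cfgAt R x k y (t₀ + 1)).visited) := by
  induction d with
  | zero =>
    intro t q tp cs h1 h2 hcs hv hR
    obtain rfl : t = T := by omega
    have hch : (cs i).choicePos = 0 := by
      have := choicePos_le_visited (M := M i) (R := R) (x := x) (k := k) (y := y) t
      rw [← hcs] at this; omega
    have hδ := hR.delta (R := R) (x := x) (k := k) y
    rw [hch] at hδ
    have hn : (M i).action R x k y (cs i) = none := by
      have := hT
      unfold HaltedAt Machine.step at this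
      rw [← hcs] at this
      simpa using this
    refine ⟨t, q, tp, reaches_idle_stay le_rfl ?_, ?_, le_rfl, by rw [← hcs]; exact hv, Or.inl hT⟩
    · rw [hn] at hδ
      simp only [choiceRead] at hδ
      simp only [action, δ, hδ]
    · rw [← hcs, Function.update_eq_self]; exact hR
  | succ d ih =>
    intro t q tp cs h1 h2 hcs hv hR
    have hch : (cs i).choicePos = 0 := by
      have := choicePos_le_visited (M := M i) (R := R) (x := x) (k := k) (y := y) t
      rw [← hcs] at this; omega
    have hδ := hR.delta (R := R) (x := x) (k := k) y
    rw [hch] at hδ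
    simp only [choiceRead] at hδ
    rcases hn : (M i).action R x k y (cs i) with _ | a
    · have hH : (M i).HaltedAt R x k y t := by
        unfold HaltedAt Machine.step; rw [← hcs, hn]; rfl
      refine ⟨t, q, tp, (reaches_idle_stay le_rfl ?_).mono (by omega), ?_, h2,
        by rw [← hcs]; exact hv, Or.inl hH⟩
      · rw [hn] at hδ
        simp only [action, δ, hδ]
      · rw [← hcs, Function.update_eq_self]; exact hR
    · rw [hn] at hδ
      obtain ⟨c', hstep⟩ : ∃ c', (M i).step R x k y (cs i) = some c' := by
        unfold Machine.step; rw [hn]; exact ⟨_, rfl⟩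
      have hc' : (M i).cfgAt R x k y (t + 1) = c' := by
        rw [cfgAt_succ, ← hcs, next_of_step hstep]
      have hc'v : c'.visited = moveChoice a.choiceMove 0 := by
        unfold Machine.step at hstep
        rw [hn] at hstep
        simp only [Option.map_some, Option.some.injEq] at hstep
        rw [← hstep]; simp [hv, hch]
      by_cases hm : a.choiceMove = Move.right
      · refine ⟨t, q, tp, (reaches_idle_stay le_rfl ?_).mono (by omega), ?_, h2,
          by rw [← hcs]; exact hv, Or.inr ?_⟩
        · simp only [action, δ, hδ, hm]
        · rw [← hcs, Function.update_eq_self]; exact hR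
        · rw [hc', hc'v, hm]; simp [moveChoice]
      · have hc'0 : c'.visited = 0 := by
          rw [hc'v]; cases hh : a.choiceMove <;> simp_all [moveChoice]
        have htT : t ≠ T := by
          rintro rfl
          have := hT
          unfold HaltedAt at this
          rw [← hcs, hstep] at this
          cases this
        obtain ⟨q', tp', hs, hR'⟩ := hR.step (prod := prod) (Y := Y) (c := Ctrl.pre i)
          (c' := Ctrl.pre i) hn hstep
          (by rw [hcs]; exact hS i y t) (by rw [← hc']; exact hS i y _) le_rfl
          (h := 0) (v := 0) (by
            simp only [action, δ, hδ])
        obtain ⟨t₀, q'', tp'', hs', hR'', h3, h4, h5⟩ := ih (t := t + 1) (by omega) (by omega)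
          (by simp [hc']) (by simp [hc'0]) hR'
        refine ⟨t₀, q'', tp'', (hs.trans hs').mono (by omega), ?_, h3, h4, h5⟩
        simpa using hR''

end Comb

/-! ### Simulated runs beyond the first nondeterministic step -/

namespace Comb

open Machine

variable {prod : Bool} {M : Bool → Machine} {R : InputRelations} {x : List Bool} {k : ℕ}
  {Y : ℕ → Bool} {q : ∀ j, (M j).State} {tp : TapeIx (Work M) → Tape (Extra M)}
  {h v S : ℕ} {i : Bool}

/-- Block `j` of the choice tape consists of the bits `a + 3 * j`, `a + 3 * j + 1` and
`a + 3 * j + 2`. The choice tape of a simulated machine consists of the first bits of the blocks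
`1, 2, …`. -/
def payload (Y : ℕ → Bool) (a p : ℕ) : Bool := Y (a + 3 * (p + 1))

/-- The second and third bits of the blocks `0, …, V`, apart from the third bit of block `V`, are
as they should be: the second bit is set in block `0` only, and the third bit is set in none of the
blocks `0, …, V - 1`. -/
structure Marks (Y : ℕ → Bool) (a V : ℕ) : Prop where
  start : Y (a + 1) = true
  inner : ∀ j, 0 < j → j ≤ V → Y (a + 3 * j + 1) = false
  last : ∀ j < V, Y (a + 3 * j + 2) = false

theorem Marks.mono {a V V' : ℕ} (hM : Marks Y a V') (hV : V ≤ V') : Marks Y a V :=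
  ⟨hM.start, fun j h0 hj => hM.inner j h0 (hj.trans hV), fun j hj => hM.last j (hj.trans_le hV)⟩

theorem reaches_fetch (κ : Fetch) (seen : Bool) :
    Reaches R x k Y 4 (conf prod q (Ctrl.fetch₀ κ seen) tp h v)
      (conf prod q (dispatch prod κ seen (Y h) (Y (h + 1)) (Y (h + 2))) tp (h + 3)
        (max v (h + 3))) := by
  have h0 := reaches_idle (prod := prod) (R := R) (x := x) (k := k) (Y := Y) (q := q) (tp := tp)
    (h := h) (v := v) (c := Ctrl.fetch₀ κ seen) (c' := Ctrl.fetch₁ κ seen) (m := Move.right)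
    (by simp only [action, δ])
  have h1 := reaches_idle (prod := prod) (R := R) (x := x) (k := k) (Y := Y) (q := q) (tp := tp)
    (h := h + 1) (v := max v (h + 1)) (c := Ctrl.fetch₁ κ seen) (c' := Ctrl.fetch₂ κ seen (Y h))
    (m := Move.right) (by simp only [action, δ, choiceRead, Option.getD_some])
  have h2 := reaches_idle (prod := prod) (R := R) (x := x) (k := k) (Y := Y) (q := q) (tp := tp)
    (h := h + 2) (v := max (max v (h + 1)) (h + 2)) (c := Ctrl.fetch₂ κ seen (Y h))
    (c' := Ctrl.fetch₃ κ seen (Y h) (Y (h + 1)))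
    (m := Move.right) (by simp only [action, δ, choiceRead, Option.getD_some])
  have h3 := reaches_idle_stay (prod := prod) (R := R) (x := x) (k := k) (Y := Y) (q := q) (tp := tp)
    (h := h + 3) (v := max (max (max v (h + 1)) (h + 2)) (h + 3))
    (c := Ctrl.fetch₃ κ seen (Y h) (Y (h + 1)))
    (c' := dispatch prod κ seen (Y h) (Y (h + 1)) (Y (h + 2)))
    (le_max_right _ _) (by simp only [action, δ, choiceRead, Option.getD_some])
  have := ((h0.trans h1).trans h2).trans h3
  rwa [show max (max (max v (h + 1)) (h + 2)) (h + 3) = max v (h + 3) by omega] at this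

theorem reaches_back (hl : leftMove M = Move.left) (seen : Bool) (n : ℕ) (hn : n < 7)
    (hv : h + n ≤ v) :
    Reaches R x k Y (n + 1) (conf prod q (Ctrl.back ⟨n, hn⟩ i seen) tp (h + n) v)
      (conf prod q (Ctrl.fetch₀ (Fetch.left i) seen) tp h v) := by
  induction n with
  | zero => exact reaches_idle_stay hv (by simp only [action, δ])
  | succ n ih =>
    have h1 := reaches_idle (prod := prod) (R := R) (x := x) (k := k) (Y := Y) (q := q) (tp := tp)
      (h := h + (n + 1)) (v := v) (c := Ctrl.back ⟨n + 1, hn⟩ i seen)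
      (c' := Ctrl.back ⟨n, Nat.lt_of_succ_lt hn⟩ i seen)
      (m := Move.left) (by simp only [action, δ, hl])
    have h2 : moveChoice Move.left (h + (n + 1)) = h + n := by simp [moveChoice]
    rw [h2, show max v (h + n) = v by omega] at h1
    exact (h1.trans (ih (Nat.lt_of_succ_lt hn) (by omega))).mono (by omega)

/-- The configuration of the combined machine that represents the configuration `c` of machine `i`
if the choice bits of machine `i` are taken from the blocks that start at position `a`. -/
abbrev simConf (prod : Bool) (Y : ℕ → Bool) (a : ℕ) (i : Bool) (c : Cfg (M i))
    (q : ∀ j, (M j).State) (tp : TapeIx (Work M) → Tape (Extra M)) : Cfg (comb prod M) :=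
  conf prod q (Ctrl.sim i (choiceRead (payload Y a) c.choicePos) (Y (a + 3 * c.choicePos + 2))
    (Y (a + 3 * c.visited + 2))) tp (a + 3 * (c.choicePos + 1)) (a + 3 * (c.visited + 1))

/-- Within `N` steps the machine halts in a rejecting configuration, with few visited cells. -/
def Rejects (R : InputRelations) (x : List Bool) (k : ℕ) (Y : ℕ → Bool) (S N : ℕ)
    (cc : Cfg (comb prod M)) (w : ℕ) : Prop :=
  ∃ cs q tp h v, Reaches R x k Y N cc (conf prod q (Ctrl.halt false) tp h v) ∧ v ≤ w ∧
    Rep S cs q tp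

theorem Rejects.mono {N N' w w' : ℕ} {cc : Cfg (comb prod M)} (hr : Rejects R x k Y S N cc w)
    (hN : N ≤ N') (hw : w ≤ w') : Rejects R x k Y S N' cc w' := by
  obtain ⟨cs, q, tp, h, v, h1, h2, h3⟩ := hr
  exact ⟨cs, q, tp, h, v, h1.mono hN, h2.trans hw, h3⟩

theorem Rejects.of_reaches {N N' w : ℕ} {cc cc' : Cfg (comb prod M)}
    (hs : Reaches R x k Y N cc cc') (hr : Rejects R x k Y S N' cc' w) :
    Rejects R x k Y S (N + N') cc w := by
  obtain ⟨cs, q, tp, h, v, h1, h2, h3⟩ := hr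
  exact ⟨cs, q, tp, h, v, hs.trans h1, h2, h3⟩

/-- One step of machine `i` is simulated within `12` steps, or the combined machine finds a wrong mark
in the blocks up to the one that machine `i` has entered, and rejects. The number `12` is attained by
moves to the left: the step itself, six cells to the left, and the fetching of the block. -/
theorem sim_step {a : ℕ} {cs : ∀ j, Cfg (M j)} {c' : Cfg (M i)} (hR : RepOn S cs q tp i)
    (hstep : (M i).step R x k (payload Y a) (cs i) = some c') (hs : Small S (cs i))
    (hs' : Small S c') (hpv : (cs i).choicePos ≤ (cs i).visited) (hM : Marks Y a (cs i).visited) :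
    (∃ q' tp', Reaches R x k Y 12 (simConf prod Y a i (cs i) q tp)
        (simConf prod Y a i c' q' tp') ∧
      RepOn S (Function.update cs i c') q' tp' i ∧ Marks Y a c'.visited) ∨
    (Rejects R x k Y S 12 (simConf prod Y a i (cs i) q tp) (a + 3 * (c'.visited + 1)) ∧
      ¬ Marks Y a c'.visited) := by
  have hδ := hR.delta (R := R) (x := x) (k := k) (payload Y a)
  obtain ⟨act, ha, hc'⟩ := Option.map_eq_some_iff.1 hstep
  rw [ha] at hδ
  have hc'p : c'.choicePos = moveChoice act.choiceMove (cs i).choicePos := by rw [← hc']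
  have hc'v : c'.visited = max (cs i).visited (moveChoice act.choiceMove (cs i).choicePos) := by
    rw [← hc']
  set p := (cs i).choicePos with hp
  set V := (cs i).visited with hV
  cases hm : act.choiceMove with
  | stay =>
    left
    rw [hm] at hc'p hc'v
    simp only [moveChoice] at hc'p hc'v
    obtain ⟨q', tp', hr, hR'⟩ := hR.step (prod := prod) (Y := Y) (c := Ctrl.sim i
        (choiceRead (payload Y a) p) (Y (a + 3 * p + 2)) (Y (a + 3 * V + 2)))
      (c' := Ctrl.sim i (choiceRead (payload Y a) p) (Y (a + 3 * p + 2)) (Y (a + 3 * V + 2)))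
      (h := a + 3 * (p + 1)) (v := a + 3 * (V + 1)) ha hstep hs hs' (by omega)
      (by simp only [action, δ, hδ, hm])
    have hv' : c'.visited = V := by omega
    refine ⟨q', tp', ?_, hR', by rwa [hv']⟩
    unfold simConf
    rw [hc'p, hv']
    exact hr.mono (by omega)
  | right =>
    rw [hm] at hc'p hc'v
    simp only [moveChoice] at hc'p hc'v
    cases he : Y (a + 3 * p + 2) with
    | true =>
      right
      -- the scanned block claims to be the last one, but machine `i` enters the next one
      refine ⟨⟨cs, q, tp, _, _, (reaches_idle_stay (by omega) ?_).mono (by omega), ?_,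
        hR.toRep⟩, fun hM' => ?_⟩
      · simp only [action, δ, ← hp, ← hV, hδ, hm, he, if_true]
      · omega
      · have := hM'.last p (by omega)
        rw [he] at this; cases this
    | false =>
      obtain ⟨q', tp', hr, hR'⟩ := hR.step (prod := prod) (Y := Y) (c := Ctrl.sim i
          (choiceRead (payload Y a) p) (Y (a + 3 * p + 2)) (Y (a + 3 * V + 2)))
        (c' := Ctrl.fetch₀ (Fetch.right i) (Y (a + 3 * V + 2)))
        (h := a + 3 * (p + 1)) (v := a + 3 * (V + 1)) ha hstep hs hs' (by omega)
        (by simp only [action, δ, hδ, hm, he]; rfl)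
      have hf := hr.trans (reaches_fetch _ _)
      have hvv : max (a + 3 * (V + 1)) (a + 3 * (p + 1) + 3) = a + 3 * (c'.visited + 1) := by omega
      rw [hvv] at hf
      cases hmark : Y (a + 3 * (p + 1) + 1) with
      | true =>
        right
        simp only [dispatch, hmark, if_true] at hf
        refine ⟨⟨_, q', tp', _, _, hf.mono (by omega), le_rfl, hR'.toRep⟩, fun hM' => ?_⟩
        have := hM'.inner (p + 1) (by omega) (by omega)
        rw [hmark] at this; cases this
      | false =>
        left
        have hM' : Marks Y a c'.visited := by
          refine ⟨hM.start, fun j h0 hj => ?_, fun j hj => ?_⟩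
          · rcases le_or_gt j V with hjV | hjV
            · exact hM.inner j h0 hjV
            · obtain rfl : j = p + 1 := by omega
              exact hmark
          · rcases lt_or_ge j V with hjV | hjV
            · exact hM.last j hjV
            · obtain rfl : j = p := by omega
              exact he
        refine ⟨q', tp', ?_, hR', hM'⟩
        -- end bits can be set in the last visited block only, so `seen` tells its end bit
        have hseen : (Y (a + 3 * V + 2) || Y (a + 3 * (p + 1) + 2)) =
            Y (a + 3 * c'.visited + 2) := by
          rcases lt_trichotomy (p + 1) V with hpV | hpV | hpV
          · have := hM.last (p + 1) hpV
            have hcv : c'.visited = V := by omega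
            rw [this, hcv]; simp
          · have hcv : c'.visited = V := by omega
            rw [hcv, hpV]; simp
          · have hpV' : V = p := by omega
            have hcv : c'.visited = p + 1 := by omega
            rw [hcv, hpV', he]; simp
        simp only [dispatch, hmark, hseen] at hf
        unfold simConf
        rw [hc'p]
        simp only [choiceRead, payload]
        exact hf.mono (by omega)
  | left =>
    left
    rw [hm] at hc'p hc'v
    simp only [moveChoice] at hc'p hc'v
    have hv' : c'.visited = V := by omega
    rw [hv']
    rcases Nat.eq_zero_or_pos p with hp0 | hp0
    · rw [hp0] at hδ
      obtain ⟨q', tp', hr, hR'⟩ := hR.step (prod := prod) (Y := Y) (c := Ctrl.sim i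
          none (Y (a + 3 * p + 2)) (Y (a + 3 * V + 2)))
        (c' := Ctrl.sim i none (Y (a + 3 * p + 2)) (Y (a + 3 * V + 2)))
        (h := a + 3 * (p + 1)) (v := a + 3 * (V + 1)) ha hstep hs hs' (by omega)
        (by simp only [choiceRead] at hδ; simp only [action, δ, hδ, hm])
      refine ⟨q', tp', ?_, hR', hM⟩
      unfold simConf
      have hc0 : c'.choicePos = 0 := by omega
      rw [hc0, hv', ← hp, ← hV, hp0]
      rw [hp0] at hr
      exact hr.mono (by omega)
    · obtain ⟨p', hp'⟩ := Nat.exists_eq_succ_of_ne_zero hp0.ne'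
      have hl : leftMove M = Move.left := by
        unfold leftMove
        rw [if_neg]
        intro hro
        exact hro i _ _ _ _ _ _ ha hm
      rw [hp'] at hδ
      obtain ⟨q', tp', hr, hR'⟩ := hR.step (prod := prod) (Y := Y) (c := Ctrl.sim i
          (choiceRead (payload Y a) p) (Y (a + 3 * p + 2)) (Y (a + 3 * V + 2)))
        (c' := Ctrl.back 6 i (Y (a + 3 * V + 2)))
        (h := a + 3 * (p + 1)) (v := a + 3 * (V + 1)) ha hstep hs hs' (by omega)
        (by simp only [choiceRead] at hδ
            simp only [action, δ, hp', choiceRead, Nat.succ_eq_add_one, hδ, hm])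
      have hb := reaches_back (prod := prod) (R := R) (x := x) (k := k) (Y := Y) (q := q')
        (tp := tp') (i := i) (h := a + 3 * p') (v := a + 3 * (V + 1)) hl (Y (a + 3 * V + 2)) 6
        (by omega) (by omega)
      rw [show a + 3 * p' + 6 = a + 3 * (p + 1) by omega] at hb
      have hf := (hr.trans hb).trans (reaches_fetch _ _)
      refine ⟨q', tp', ?_, hR', hM⟩
      have hc1 : c'.choicePos = p' := by omega
      rw [show max (a + 3 * (V + 1)) (a + 3 * p' + 3) = a + 3 * (V + 1) by omega] at hf
      have hcur : (if Y (a + 3 * p' + 1) = true then none else some (Y (a + 3 * p'))) =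
          choiceRead (payload Y a) p' := by
        rcases p' with _ | p''
        · simp [hM.start, choiceRead]
        · rw [hM.inner (p'' + 1) (by omega) (by omega)]
          simp [choiceRead, payload]
      simp only [dispatch, hcur] at hf
      unfold simConf
      rw [hc1, hv']
      exact hf.mono (by omega)

/-- Machine `i` is simulated until it halts, unless a wrong mark is found. -/
theorem sim_run (hS : AllSmall R x k S M) {a : ℕ} (d : ℕ) :
    ∀ {t q tp} {cs : ∀ j, Cfg (M j)}, (M i).HaltedAt R x k (payload Y a) (t + d) →
      cs i = (M i).cfgAt R x k (payload Y a) t → RepOn S cs q tp i → Marks Y a (cs i).visited →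
    ∃ T, (M i).HaltedAt R x k (payload Y a) T ∧
      ((∃ q' tp', Reaches R x k Y (12 * d) (simConf prod Y a i (cs i) q tp)
          (simConf prod Y a i ((M i).cfgAt R x k (payload Y a) T) q' tp') ∧
        RepOn S (Function.update cs i ((M i).cfgAt R x k (payload Y a) T)) q' tp' i ∧
        Marks Y a ((M i).cfgAt R x k (payload Y a) T).visited) ∨
      (Rejects R x k Y S (12 * d) (simConf prod Y a i (cs i) q tp)
          (a + 3 * (((M i).cfgAt R x k (payload Y a) T).visited + 1)) ∧
        ¬ Marks Y a ((M i).cfgAt R x k (payload Y a) T).visited)) := by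
  induction d with
  | zero =>
    intro t q tp cs hT hcs hR hM
    refine ⟨t, hT, Or.inl ⟨q, tp, ?_, ?_, ?_⟩⟩
    · rw [hcs]; exact Reaches.refl _ _
    · rw [← hcs, Function.update_eq_self]; exact hR
    · rw [← hcs]; exact hM
  | succ d ih =>
    intro t q tp cs hT hcs hR hM
    rcases hstep : (M i).step R x k (payload Y a) (cs i) with _ | c'
    · refine ⟨t, by unfold HaltedAt; rw [← hcs]; exact hstep, Or.inl ⟨q, tp, ?_, ?_, ?_⟩⟩
      · rw [hcs]; exact Reaches.refl _ _
      · rw [← hcs, Function.update_eq_self]; exact hR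
      · rw [← hcs]; exact hM
    · have hc' : (M i).cfgAt R x k (payload Y a) (t + 1) = c' := by
        rw [cfgAt_succ, ← hcs, next_of_step hstep]
      rcases sim_step (prod := prod) hR hstep (by rw [hcs]; exact hS _ _ _)
        (by rw [← hc']; exact hS _ _ _) (by rw [hcs]; exact choicePos_le_visited _) hM with
        ⟨q', tp', hr, hR', hM'⟩ | ⟨hr, hM'⟩
      · obtain ⟨T, hT', hres⟩ := ih (t := t + 1) (q := q') (tp := tp')
          (cs := Function.update cs i c') (by rwa [show t + 1 + d = t + (d + 1) by omega])
          (by simp [hc']) hR' (by simpa using hM')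
        simp only [Function.update_self, Function.update_idem] at hres
        refine ⟨T, hT', ?_⟩
        rcases hres with ⟨q'', tp'', hr', hR'', hM''⟩ | ⟨hr', hM''⟩
        · exact Or.inl ⟨q'', tp'', (hr.trans hr').mono (by omega), hR'', hM''⟩
        · exact Or.inr ⟨(Rejects.of_reaches hr hr').mono (by omega) le_rfl, hM''⟩
      · have hle : c'.visited ≤ ((M i).cfgAt R x k (payload Y a) (t + (d + 1))).visited := by
          rw [← hc']; exact visited_mono (by omega)
        exact ⟨_, hT, Or.inr ⟨hr.mono (by omega) (by omega), fun h => hM' (h.mono hle)⟩⟩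

end Comb

/-! ### The outcome of the nondeterministic part -/

namespace Comb

open Machine

variable {prod : Bool} {M : Bool → Machine} {R : InputRelations} {x : List Bool} {k : ℕ}
  {Y : ℕ → Bool} {q : ∀ j, (M j).State} {tp : TapeIx (Work M) → Tape (Extra M)}
  {h v S : ℕ} {i : Bool}

/-- The blocks that start at position `a` describe an accepting path of `N` with `v` bits: the path
consists of the first bits of the blocks `1, …, v`, and the other bits of the blocks `0, …, v` are
as they should be (the third bit is set in the last of these blocks only). -/
def Accepts (N : Machine) (R : InputRelations) (x : List Bool) (k : ℕ) (Y : ℕ → Bool) (a v : ℕ) :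
    Prop :=
  ∃ T, N.HaltedAt R x k (payload Y a) T ∧
    N.accept (N.cfgAt R x k (payload Y a) T).state = true ∧
    (N.cfgAt R x k (payload Y a) T).visited = v ∧ Marks Y a v ∧ Y (a + 3 * v + 2) = true

theorem Accepts.unique {N : Machine} {a v v' : ℕ} (h : Accepts N R x k Y a v)
    (h' : Accepts N R x k Y a v') : v = v' := by
  obtain ⟨T, hT, -, hv, -⟩ := h
  obtain ⟨T', hT', -, hv', -⟩ := h'
  rw [← hv, ← hv', HaltedAt.cfgAt_eq hT hT']

/-- Within `N` steps the combined machine halts with at most `W` visited choice bits and short tapes,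
and it accepts with exactly `w` visited choice bits iff `P w`. -/
def Decides (R : InputRelations) (x : List Bool) (k : ℕ) (Y : ℕ → Bool) (S N : ℕ)
    (cc : Cfg (comb prod M)) (W : ℕ) (P : ℕ → Prop) : Prop :=
  ∃ cc', Reaches R x k Y N cc cc' ∧ (comb prod M).step R x k Y cc' = none ∧
    (∀ w, ((comb prod M).accept cc'.state = true ∧ cc'.visited = w) ↔ P w) ∧ cc'.visited ≤ W ∧
    ∀ τ, (cc'.tapes τ).cells.length ≤ S + 1

theorem Decides.of_reaches {N N' N'' W : ℕ} {P : ℕ → Prop} {cc cc' : Cfg (comb prod M)}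
    (hs : Reaches R x k Y N cc cc') (hd : Decides R x k Y S N' cc' W P) (hN : N + N' ≤ N'') :
    Decides R x k Y S N'' cc W P := by
  obtain ⟨c, h1, h2⟩ := hd
  exact ⟨c, (hs.trans h1).mono hN, h2⟩

theorem Decides.weaken {N N' W W' : ℕ} {P P' : ℕ → Prop} {cc : Cfg (comb prod M)}
    (hd : Decides R x k Y S N cc W P) (hN : N ≤ N') (hW : W ≤ W') (hP : ∀ w, P w ↔ P' w) :
    Decides R x k Y S N' cc W' P' := by
  obtain ⟨c, h1, h2, h3, h4, h5⟩ := hd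
  exact ⟨c, h1.mono hN, h2, fun w => (h3 w).trans (hP w), h4.trans hW, h5⟩

theorem Rejects.decides {N W : ℕ} {P : ℕ → Prop} {cc : Cfg (comb prod M)}
    (hr : Rejects R x k Y S N cc W) (hP : ∀ w, ¬ P w) : Decides R x k Y S N cc W P := by
  obtain ⟨cs, q, tp, h, v, h1, h2, h3⟩ := hr
  exact ⟨_, h1, rfl, fun w => by simp [hP w], h2, h3.length_le⟩

/-- What happens when the simulated run of machine `i` comes to its end. -/
theorem sim_finish (hS : AllSmall R x k S M) {a Vb d t : ℕ} {cs : ∀ j, Cfg (M j)}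
    (hVb : ∀ y t, ((M i).cfgAt R x k y t).visited ≤ Vb)
    (hT : (M i).HaltedAt R x k (payload Y a) (t + d))
    (hcs : cs i = (M i).cfgAt R x k (payload Y a) t) (hR : RepOn S cs q tp i)
    (hM : Marks Y a (cs i).visited) :
    (∃ c q' tp', c.choicePos ≤ c.visited ∧ c.visited ≤ Vb ∧
      Reaches R x k Y (12 * d + 1) (simConf prod Y a i (cs i) q tp)
        (conf prod q' (finish prod i true (Y (a + 3 * c.choicePos + 2))) tp'
          (a + 3 * (c.choicePos + 1)) (a + 3 * (c.visited + 1))) ∧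
      RepOn S (Function.update cs i c) q' tp' i ∧ Accepts (M i) R x k Y a c.visited) ∨
    (Rejects R x k Y S (12 * d + 1) (simConf prod Y a i (cs i) q tp) (a + 3 * (Vb + 1)) ∧
      ∀ v, ¬ Accepts (M i) R x k Y a v) := by
  obtain ⟨T, hT', ⟨q', tp', hr, hR', hM'⟩ | ⟨hr, hM'⟩⟩ := sim_run (prod := prod) hS d hT hcs hR hM
  · set c := (M i).cfgAt R x k (payload Y a) T with hc
    have hδ := hR'.delta (R := R) (x := x) (k := k) (payload Y a)
    have hn : (M i).action R x k (payload Y a) c = none := by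
      unfold HaltedAt Machine.step at hT'
      simpa using hT'
    simp only [Function.update_self] at hδ
    rw [hn] at hδ
    have hq : q' i = c.state := by simpa using hR'.state i
    have hpv : c.choicePos ≤ c.visited := choicePos_le_visited T
    have hVc : c.visited ≤ Vb := hVb _ _
    have hs := hr.trans (reaches_idle_stay (prod := prod) (R := R) (x := x) (k := k) (Y := Y)
      (q := q') (tp := tp') (h := a + 3 * (c.choicePos + 1)) (v := a + 3 * (c.visited + 1))
      (c := Ctrl.sim i (choiceRead (payload Y a) c.choicePos) (Y (a + 3 * c.choicePos + 2))
        (Y (a + 3 * c.visited + 2)))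
      (c' := finish prod i ((M i).accept (q' i) && Y (a + 3 * c.visited + 2))
        (Y (a + 3 * c.choicePos + 2))) (by omega) (by simp only [action, δ, hδ]))
    by_cases hok : ((M i).accept (q' i) && Y (a + 3 * c.visited + 2)) = true
    · left
      rw [hok] at hs
      rw [Bool.and_eq_true, hq] at hok
      exact ⟨c, q', tp', hpv, hVc, hs, hR', T, hT', hok.1, rfl, hM', hok.2⟩
    · right
      refine ⟨⟨_, q', tp', a + 3 * (c.choicePos + 1), a + 3 * (c.visited + 1), ?_, by omega,
        hR'.toRep⟩, ?_⟩
      · simpa only [finish, hok, Bool.false_eq_true, if_false] using hs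
      · rintro v ⟨T', hT'', hacc, hv, -, hlast⟩
        rw [HaltedAt.cfgAt_eq hT'' hT', ← hc] at hacc hv
        rw [hq, hacc, hv, hlast] at hok
        exact hok rfl
  · refine Or.inr ⟨hr.mono (by omega) ?_, ?_⟩
    · have := hVb (payload Y a) T
      omega
    · rintro v ⟨T', hT'', -, hv, hm, -⟩
      rw [HaltedAt.cfgAt_eq hT'' hT'] at hv
      exact hM' (hv ▸ hm)

/-- The simulated run of machine `i`, if nothing has to be done after it. -/
theorem decides_sim (hfin : (prod && !i) = false) (hS : AllSmall R x k S M) {a Vb d t : ℕ}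
    {cs : ∀ j, Cfg (M j)} (hVb : ∀ y t, ((M i).cfgAt R x k y t).visited ≤ Vb)
    (hT : (M i).HaltedAt R x k (payload Y a) (t + d))
    (hcs : cs i = (M i).cfgAt R x k (payload Y a) t) (hR : RepOn S cs q tp i)
    (hM : Marks Y a (cs i).visited) :
    Decides R x k Y S (12 * d + 1) (simConf prod Y a i (cs i) q tp) (a + 3 * (Vb + 1))
      fun w => ∃ v, Accepts (M i) R x k Y a v ∧ w = a + 3 * (v + 1) := by
  rcases sim_finish (prod := prod) hS hVb hT hcs hR hM with
    ⟨c, q', tp', h1, h2, hr, hR', hacc⟩ | ⟨hr, hn⟩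
  · simp only [finish, hfin, if_true] at hr
    refine ⟨_, hr, rfl, fun w => ⟨?_, ?_⟩, by simp only; omega, hR'.length_le⟩
    · rintro ⟨-, rfl⟩
      exact ⟨_, hacc, rfl⟩
    · rintro ⟨v, hv, rfl⟩
      exact ⟨rfl, by rw [hacc.unique hv]⟩
  · exact hr.decides fun w ⟨v, hv, _⟩ => hn v hv

/-- After the run of the first machine the head moves to the end of the last block of that run. -/
theorem reaches_skip {a V : ℕ} (hM : Marks Y a V) (hl : Y (a + 3 * V + 2) = true) (d : ℕ) :
    ∀ {p}, p + d + 1 = V →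
    Reaches R x k Y (4 * (d + 1))
      (conf prod q (Ctrl.fetch₀ Fetch.skip false) tp (a + 3 * (p + 1)) (a + 3 * (V + 1)))
      (conf prod q (Ctrl.fetch₀ (Fetch.header true) false) tp (a + 3 * (V + 1))
        (a + 3 * (V + 1))) := by
  induction d with
  | zero =>
    intro p hp
    have := reaches_fetch (prod := prod) (R := R) (x := x) (k := k) (Y := Y) (q := q) (tp := tp)
      (h := a + 3 * (p + 1)) (v := a + 3 * (V + 1)) Fetch.skip false
    obtain rfl : V = p + 1 := by omega
    simp only [dispatch, hl, if_true] at this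
    rwa [show max (a + 3 * (p + 1 + 1)) (a + 3 * (p + 1) + 3) = a + 3 * (p + 1 + 1) by omega] at this
  | succ d ih =>
    intro p hp
    have := reaches_fetch (prod := prod) (R := R) (x := x) (k := k) (Y := Y) (q := q) (tp := tp)
      (h := a + 3 * (p + 1)) (v := a + 3 * (V + 1)) Fetch.skip false
    have hlast := hM.last (p + 1) (by omega)
    simp only [dispatch, hlast] at this
    rw [show max (a + 3 * (V + 1)) (a + 3 * (p + 1) + 3) = a + 3 * (V + 1) by omega] at this
    exact (this.trans (ih (p := p + 1) (by omega))).mono (by omega)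

/-- The configuration `c` precedes every nondeterministic step, and machine `N` halts within `d`
steps from it. -/
def Ready (R : InputRelations) (x : List Bool) (k d : ℕ) {N : Machine} (c : Cfg N) : Prop :=
  c.visited = 0 ∧ c.choicePos = 0 ∧
    ∀ y, ∃ t, c = N.cfgAt R x k y t ∧ N.HaltedAt R x k y (t + d)

theorem Marks.zero {a : ℕ} (h : Y (a + 1) = true) : Marks Y a 0 :=
  ⟨h, fun j h1 h2 => by omega, fun j hj => by omega⟩

theorem Accepts.start {N : Machine} {a v : ℕ} (h : Accepts N R x k Y a v) : Y (a + 1) = true := by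
  obtain ⟨_, -, -, -, h, -⟩ := h
  exact h.start

/-- The run of the second machine, which needs its special tapes to be loaded first. It is the last
run both in sums and in products. -/
theorem decides_true (hS : AllSmall R x k S M) {a Vb d : ℕ} {stage seen : Bool}
    {cs : ∀ j, Cfg (M j)} (hVb : ∀ i y t, ((M i).cfgAt R x k y t).visited ≤ Vb)
    (hr : Ready R x k d (cs true)) (hR : Rep S cs q tp) (ha : Y a = true)
    (hst : (!prod || true == stage) = true) :
    Decides R x k Y S (8 * S + 12 * d + 15) (conf prod q (Ctrl.fetch₀ (Fetch.header stage) seen) tp a a)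
      (a + 3 * (Vb + 1)) fun w => ∃ v, Accepts (M true) R x k Y a v ∧ w = a + 3 * (v + 1) := by
  have hf := reaches_fetch (prod := prod) (R := R) (x := x) (k := k) (Y := Y) (q := q) (tp := tp)
    (h := a) (v := a) (Fetch.header stage) seen
  rw [show max a (a + 3) = a + 3 by omega] at hf
  cases hm : Y (a + 1) with
  | false =>
    simp only [dispatch, hm] at hf
    have : Rejects R x k Y S (8 * S + 12 * d + 15)
        (conf prod q (Ctrl.fetch₀ (Fetch.header stage) seen) tp a a) (a + 3 * (Vb + 1)) :=
      ⟨_, _, _, _, _, hf.mono (by omega), by omega, hR⟩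
    refine this.decides ?_
    rintro w ⟨v, hv, -⟩
    have := hv.start
    rw [hm] at this; cases this
  | true =>
    simp only [dispatch, hm, ha, hst, if_true, Bool.and_self] at hf
    obtain ⟨tp', hl, hI, hA⟩ := reaches_load (prod := prod) (R := R) (x := x) (k := k) (Y := Y)
      (q := q) (tp := tp) (i := true) (e := Y (a + 2)) (h := a + 3) (v := a + 3) le_rfl hR.inv
    obtain ⟨h1, h2, h3⟩ := hr
    obtain ⟨t, ht, hT⟩ := h3 (payload Y a)
    have hd := decides_sim (prod := prod) (i := true) (by simp) hS (hVb true) hT ht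
      ⟨⟨hR.state, hI⟩, hA⟩ (by rw [h1]; exact Marks.zero hm)
    refine Decides.of_reaches (hf.trans hl) ?_ (show _ + (12 * d + 1) ≤ _ by omega)
    simpa only [simConf, h1, h2, if_true, choiceRead, mul_zero, add_zero, zero_add, mul_one] using hd

theorem decides_sum (hS : AllSmall R x k S M) {Vb d : ℕ} {cs : ∀ j, Cfg (M j)}
    (hVb : ∀ i y t, ((M i).cfgAt R x k y t).visited ≤ Vb)
    (hr : ∀ i, Ready R x k d (cs i)) (hR : RepOn S cs q tp false) :
    Decides R x k Y S (8 * S + 12 * d + 15)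
      (conf false q (Ctrl.fetch₀ (Fetch.header false) false) tp 0 0) (3 * (Vb + 1))
      fun w => ∃ v, Accepts (M (Y 0)) R x k Y 0 v ∧ w = 3 * (v + 1) := by
  cases h0 : Y 0 with
  | true =>
    exact (decides_true hS hVb (hr true) hR.toRep h0 rfl).weaken le_rfl (by omega)
      fun w => by simp
  | false =>
    have hf := reaches_fetch (prod := false) (R := R) (x := x) (k := k) (Y := Y) (q := q) (tp := tp)
      (h := 0) (v := 0) (Fetch.header false) false
    simp only [zero_add, Nat.zero_max] at hf
    cases hm : Y 1 with
    | false =>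
      simp only [dispatch, hm] at hf
      have : Rejects R x k Y S (8 * S + 12 * d + 15)
          (conf false q (Ctrl.fetch₀ (Fetch.header false) false) tp 0 0) (3 * (Vb + 1)) :=
        ⟨_, _, _, _, _, hf.mono (by omega), by omega, hR.toRep⟩
      refine this.decides ?_
      rintro w ⟨v, hv, -⟩
      have := hv.start
      rw [zero_add, hm] at this; cases this
    | true =>
      simp only [dispatch, hm, h0, Bool.not_false, Bool.true_or, if_true, Bool.and_self,
        Bool.false_eq_true, if_false] at hf
      obtain ⟨h1, h2, h3⟩ := hr false
      obtain ⟨t, ht, hT⟩ := h3 (payload Y 0)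
      have hd := decides_sim (prod := false) (i := false) (by simp) hS (hVb false) hT ht
        hR (by rw [h1]; exact Marks.zero (by simpa using hm))
      refine Decides.of_reaches hf ?_ (show _ + (12 * d + 1) ≤ _ by omega)
      simpa only [simConf, h1, h2, choiceRead, mul_zero, add_zero, zero_add, mul_one] using hd

theorem decides_mul (hS : AllSmall R x k S M) {Vb d : ℕ} {cs : ∀ j, Cfg (M j)}
    (hVb : ∀ i y t, ((M i).cfgAt R x k y t).visited ≤ Vb)
    (hr : ∀ i, Ready R x k d (cs i)) (hR : RepOn S cs q tp false) :
    Decides R x k Y S (8 * S + 24 * d + 4 * Vb + 20)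
      (conf true q (Ctrl.fetch₀ (Fetch.header false) false) tp 0 0) (6 * (Vb + 1))
      fun w => ∃ v v', Y 0 = false ∧ Accepts (M false) R x k Y 0 v ∧ Y (3 * (v + 1)) = true ∧
        Accepts (M true) R x k Y (3 * (v + 1)) v' ∧ w = 3 * (v + 1) + 3 * (v' + 1) := by
  have hf := reaches_fetch (prod := true) (R := R) (x := x) (k := k) (Y := Y) (q := q) (tp := tp)
    (h := 0) (v := 0) (Fetch.header false) false
  simp only [zero_add, Nat.zero_max] at hf
  -- the header block has to select the first machine
  by_cases hm : Y 1 = true ∧ Y 0 = false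
  swap
  · have hc : (Y 1 && (!true || Y 0 == false)) = false := by
      cases h1 : Y 1 <;> cases h0 : Y 0 <;> simp_all
    simp only [dispatch, hc] at hf
    have : Rejects R x k Y S (8 * S + 24 * d + 4 * Vb + 20)
        (conf true q (Ctrl.fetch₀ (Fetch.header false) false) tp 0 0) (6 * (Vb + 1)) :=
      ⟨_, _, _, _, _, hf.mono (by omega), by omega, hR.toRep⟩
    refine this.decides ?_
    rintro w ⟨v, v', h0, hv, -⟩
    exact hm ⟨by simpa using hv.start, h0⟩
  obtain ⟨hm, h0⟩ := hm
  simp only [dispatch, hm, h0, Bool.not_true, Bool.false_or, if_true, Bool.and_self,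
    beq_self_eq_true] at hf
  obtain ⟨h1, h2, h3⟩ := hr false
  obtain ⟨t, ht, hT⟩ := h3 (payload Y 0)
  have hd := sim_finish (prod := true) (i := false) hS (hVb false) hT ht
    hR (by rw [h1]; exact Marks.zero (by simpa using hm))
  have hsc : simConf true Y 0 false (cs false) q tp =
      conf true q (Ctrl.sim false none (Y 2) (Y 2)) tp 3 3 := by
    simp only [simConf, h1, h2, choiceRead, mul_zero, add_zero, zero_add, mul_one]
  rw [hsc] at hd
  rcases hd with ⟨c, q', tp', hpv, hcV, hs, hR', hacc⟩ | ⟨hrej, hn⟩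
  swap
  · refine ((Rejects.of_reaches hf hrej).mono (by omega) (by omega)).decides ?_
    rintro w ⟨v, v', -, hv, -⟩
    exact hn v hv
  simp only [zero_add] at hs
  have hacc' := hacc
  obtain ⟨-, -, -, -, hM, hl⟩ := hacc'
  -- the head is brought to the end of the last block of the first run
  have hs' : Reaches R x k Y (4 * Vb) (conf true q' (finish true false true
      (Y (3 * c.choicePos + 2))) tp' (3 * (c.choicePos + 1)) (3 * (c.visited + 1)))
      (conf true q' (Ctrl.fetch₀ (Fetch.header true) false) tp' (3 * (c.visited + 1))
        (3 * (c.visited + 1))) := by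
    rcases hpv.eq_or_lt with he | hlt
    · rw [zero_add] at hl
      simp only [he, finish, hl, if_true, Bool.not_false, Bool.and_self]
      exact Reaches.refl _ _
    · have hne := hM.last _ hlt
      rw [zero_add] at hne
      have := reaches_skip (prod := true) (R := R) (x := x) (k := k) (q := q') (tp := tp') hM hl
        (c.visited - c.choicePos - 1) (p := c.choicePos) (by omega)
      simp only [finish, hne, if_true, Bool.not_false, Bool.and_self]
      simp only [zero_add] at this
      exact this.mono (by omega)
  have hreach := (hf.trans hs).trans hs'
  have hcs' : Function.update cs false c true = cs true := by simp
  cases hb : Y (3 * (c.visited + 1)) with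
  | true =>
    have hd := decides_true (prod := true) (Y := Y) (a := 3 * (c.visited + 1)) (stage := true)
      (seen := false) hS hVb (by rw [hcs']; exact hr true) hR'.toRep hb rfl
    refine (Decides.of_reaches hreach hd le_rfl).weaken (by omega) (by omega) fun w => ?_
    constructor
    · rintro ⟨v', hv', rfl⟩
      exact ⟨_, v', h0, hacc, hb, hv', rfl⟩
    · rintro ⟨v, v', -, hv, -, hv', rfl⟩
      obtain rfl := hacc.unique hv
      exact ⟨v', hv', rfl⟩
  | false =>
    have hf' := reaches_fetch (prod := true) (R := R) (x := x) (k := k) (Y := Y) (q := q')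
      (tp := tp') (h := 3 * (c.visited + 1)) (v := 3 * (c.visited + 1)) (Fetch.header true) false
    have hc : (Y (3 * (c.visited + 1) + 1) && (!true || false == true)) = false := by simp
    simp only [dispatch, hb, hc] at hf'
    have : Rejects R x k Y S (8 * S + 24 * d + 4 * Vb + 20)
        (conf true q (Ctrl.fetch₀ (Fetch.header false) false) tp 0 0) (6 * (Vb + 1)) :=
      ⟨_, _, _, _, _, (hreach.trans hf').mono (by omega), by omega, hR'.toRep⟩
    refine this.decides ?_
    rintro w ⟨v, v', -, hv, hv0, -⟩
    obtain rfl := hacc.unique hv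
    rw [hb] at hv0; cases hv0

end Comb

/-! ### Complete runs of the combined machine -/

namespace Comb

open Machine

variable {prod : Bool} {M : Bool → Machine} {R : InputRelations} {x : List Bool} {k : ℕ}
  {Y : ℕ → Bool} {S : ℕ}

theorem repOn_start (hS : 0 < S) (i : Bool) :
    RepOn S (fun j => (M j).startCfg) (fun j => (M j).start) (fun _ => Tape.empty) i := by
  refine ⟨⟨fun _ => rfl, ⟨fun _ _ => Tape.good_empty hS, ?_, fun _ _ => Tape.mirrors_empty _⟩⟩,
    fun _ => Tape.mirrors_empty _⟩
  exact ⟨rfl, fun _ => rfl, by simp [Tape.empty], by simp [Tape.empty]⟩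

/-- A configuration before the first nondeterministic step does not depend on the choice tape. -/
theorem ready_of_suspended {N : Machine} {d t : ℕ} {y : ℕ → Bool}
    (hd : ∀ y t, (N.cfgAt R x k y t).visited = 0 →
      (N.HaltedAt R x k y t ∨ 0 < (N.cfgAt R x k y (t + 1)).visited) → N.HaltedAt R x k y (t + d))
    (hv : (N.cfgAt R x k y t).visited = 0)
    (hs : N.HaltedAt R x k y t ∨ 0 < (N.cfgAt R x k y (t + 1)).visited) :
    Ready R x k d (N.cfgAt R x k y t) := by
  have hch : (N.cfgAt R x k y t).choicePos = 0 := by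
    have := choicePos_le_visited (M := N) (R := R) (x := x) (k := k) (y := y) t
    omega
  refine ⟨hv, hch, fun y' => ⟨t, ?_⟩⟩
  have hc : N.cfgAt R x k y' t = N.cfgAt R x k y t := cfgAt_congr (by rw [hv]; omega)
  refine ⟨hc.symm, hd y' t (by rw [hc, hv]) ?_⟩
  rcases hs with hs | hs
  · exact Or.inl ((haltedAt_congr (by rw [hv]; omega)).2 hs)
  · right
    have hn : N.next R x k y' (N.cfgAt R x k y t) = N.next R x k y (N.cfgAt R x k y t) := by
      unfold next
      rw [step_congr (y := y') (y' := y) (by rw [hch]; rfl)]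
    rw [cfgAt_succ, hc, hn, ← cfgAt_succ]
    exact hs

/-- The deterministic part of the run: both machines are simulated up to their first
nondeterministic steps. -/
theorem reaches_header (hS : AllSmall R x k S M) {T d : ℕ}
    (hT : ∀ i y, (M i).HaltedAt R x k y T)
    (hd : ∀ i y t, ((M i).cfgAt R x k y t).visited = 0 →
      ((M i).HaltedAt R x k y t ∨ 0 < ((M i).cfgAt R x k y (t + 1)).visited) →
      (M i).HaltedAt R x k y (t + d)) :
    ∃ cs q tp, Reaches R x k Y (2 * T + 8 * S + 12) (comb prod M).startCfg
      (conf prod q (Ctrl.fetch₀ (Fetch.header false) false) tp 0 0) ∧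
      RepOn S cs q tp false ∧ ∀ i, Ready R x k d (cs i) := by
  have hS0 : 0 < S :=
    Nat.zero_lt_of_lt ((hS true (fun _ => false) 0).pos TapeIx.addr)
  obtain ⟨t₁, q₁, tp₁, hr₁, hR₁, -, hv₁, hs₁⟩ := reaches_suspend (prod := prod) (Y := Y) hS
    (hT true fun _ => false) T (t := 0) (by omega) (by omega) rfl rfl (repOn_start hS0 true)
  simp only [suspend, if_true] at hr₁
  obtain ⟨tp₂, hr₂, hI₂, hA₂⟩ := reaches_load (prod := prod) (R := R) (x := x) (k := k) (Y := Y)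
    (i := false) (e := false) (q := q₁) (h := 0) (v := 0) le_rfl hR₁.inv
  obtain ⟨t₃, q₃, tp₃, hr₃, hR₃, -, hv₃, hs₃⟩ := reaches_suspend (prod := prod) (Y := Y)
    (tp := tp₂) (q := q₁) hS (hT false fun _ => false) T (t := 0) (by omega) (by omega)
    (cs := Function.update (fun j => (M j).startCfg) true
      ((M true).cfgAt R x k (fun _ => false) t₁)) (by simp; rfl) (by simp; rfl)
    ⟨⟨hR₁.state, hI₂⟩, hA₂⟩
  refine ⟨_, q₃, tp₃, ((hr₁.trans hr₂).trans hr₃).mono (by omega), hR₃, fun i => ?_⟩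
  cases i with
  | false => simpa using ready_of_suspended (hd false) hv₃ hs₃
  | true => simpa using ready_of_suspended (hd true) hv₁ hs₁

/-- The choice bits for which the combined machine accepts, together with the number of those that
it visits. -/
def Outcome (prod : Bool) (M : Bool → Machine) (R : InputRelations) (x : List Bool) (k : ℕ)
    (Y : ℕ → Bool) (w : ℕ) : Prop :=
  match prod with
  | false => ∃ v, Accepts (M (Y 0)) R x k Y 0 v ∧ w = 3 * (v + 1)
  | true => ∃ v v', Y 0 = false ∧ Accepts (M false) R x k Y 0 v ∧ Y (3 * (v + 1)) = true ∧
      Accepts (M true) R x k Y (3 * (v + 1)) v' ∧ w = 3 * (v + 1) + 3 * (v' + 1)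

/-- The run of the combined machine: no nondeterministic step is made up to time `t₀`, and the machine
has halted at time `t₁` with the outcome and within the bounds as stated. The hypothesis on `d` bounds
the number of steps of either machine from a time when its first nondeterministic step is due. -/
theorem comb_run (prod : Bool) (Y : ℕ → Bool) (hS : AllSmall R x k S M) {T d Vb : ℕ}
    (hT : ∀ i y, (M i).HaltedAt R x k y T)
    (hd : ∀ i y t, ((M i).cfgAt R x k y t).visited = 0 →
      ((M i).HaltedAt R x k y t ∨ 0 < ((M i).cfgAt R x k y (t + 1)).visited) →
      (M i).HaltedAt R x k y (t + d))
    (hVb : ∀ i y t, ((M i).cfgAt R x k y t).visited ≤ Vb) :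
    ∃ t₀ t₁, t₀ ≤ 2 * T + 8 * S + 12 ∧ t₁ ≤ t₀ + (8 * S + 24 * d + 4 * Vb + 20) ∧
      ((comb prod M).cfgAt R x k Y t₀).visited = 0 ∧ (comb prod M).HaltedAt R x k Y t₁ ∧
      (∀ w, ((comb prod M).accept ((comb prod M).cfgAt R x k Y t₁).state = true ∧
        ((comb prod M).cfgAt R x k Y t₁).visited = w) ↔ Outcome prod M R x k Y w) ∧
      ((comb prod M).cfgAt R x k Y t₁).visited ≤ 6 * (Vb + 1) ∧
      ∀ τ, (((comb prod M).cfgAt R x k Y t₁).tapes τ).cells.length ≤ S + 1 := by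
  obtain ⟨cs, q, tp, hr, hR, hready⟩ := reaches_header (prod := prod) (Y := Y) hS hT hd
  obtain ⟨t₀, -, ht₀, hc₀⟩ := Reaches.cfgAt (s := 0) hr
  have hdec : Decides R x k Y S (8 * S + 24 * d + 4 * Vb + 20) ((comb prod M).cfgAt R x k Y t₀)
      (6 * (Vb + 1)) (Outcome prod M R x k Y) := by
    rw [hc₀]
    cases prod with
    | false =>
      exact (decides_sum hS hVb hready hR).weaken (by omega) (by omega) fun _ => Iff.rfl
    | true => exact decides_mul hS hVb hready hR
  obtain ⟨cc', hreach, h1, h2, h3, h4⟩ := hdec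
  obtain ⟨t₁, -, ht₁, rfl⟩ := hreach.cfgAt
  exact ⟨t₀, t₁, by omega, ht₁, by rw [hc₀], h1, h2, h3, h4⟩

end Comb

/-! ### Counting accepting paths -/

namespace Comb

open Machine

variable {M : Bool → Machine} {R : InputRelations} {x : List Bool} {k : ℕ} {Y : ℕ → Bool}

/-- Bit `n` of the sequence of blocks with selection bit `β` that represents the path `y`. -/
def encBit (β : Bool) (y : List Bool) (n : ℕ) : Bool :=
  if n % 3 = 0 then (if n = 0 then β else y.getD (n / 3 - 1) false)
  else if n % 3 = 1 then decide (n / 3 = 0)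
  else decide (n / 3 = y.length)

/-- The sequence of blocks with selection bit `β` that represents the path `y`. -/
def enc (β : Bool) (y : List Bool) : List Bool :=
  (List.range (3 * (y.length + 1))).map (encBit β y)

theorem encBit_zero (β : Bool) (y : List Bool) : encBit β y 0 = β := rfl

theorem encBit_payload (β : Bool) (y : List Bool) (j : ℕ) :
    encBit β y (3 * (j + 1)) = y.getD j false := by
  have h1 : 3 * (j + 1) % 3 = 0 := by omega
  have h2 : 3 * (j + 1) ≠ 0 := by omega
  have h3 : 3 * (j + 1) / 3 - 1 = j := by omega
  simp only [encBit, h1, h2, h3, if_true, if_false]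

theorem encBit_start (β : Bool) (y : List Bool) (j : ℕ) :
    encBit β y (3 * j + 1) = decide (j = 0) := by
  have h1 : (3 * j + 1) % 3 = 1 := by omega
  have h3 : (3 * j + 1) / 3 = j := by omega
  simp only [encBit, h1, h3, if_true, one_ne_zero, if_false]

theorem encBit_last (β : Bool) (y : List Bool) (j : ℕ) :
    encBit β y (3 * j + 2) = decide (j = y.length) := by
  have h1 : (3 * j + 2) % 3 = 2 := by omega
  have h3 : (3 * j + 2) / 3 = j := by omega
  simp [encBit, h1, h3]

@[simp] theorem length_enc (β : Bool) (y : List Bool) : (enc β y).length = 3 * (y.length + 1) := by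
  simp [enc]

theorem getD_enc (β : Bool) (y : List Bool) {n : ℕ} (hn : n < 3 * (y.length + 1)) :
    (enc β y).getD n false = encBit β y n := by
  simp [enc, List.getD_eq_getElem?_getD, hn]

theorem ext_getD {l l' : List Bool} (h : l.length = l'.length)
    (h' : ∀ n < l'.length, l.getD n false = l'.getD n false) : l = l' := by
  apply List.ext_getElem h
  intro n h1 h2
  have := h' n h2
  rwa [List.getD_eq_getElem _ _ h1, List.getD_eq_getElem _ _ h2] at this

theorem enc_injective {β β' : Bool} {y y' : List Bool} (h : enc β y = enc β' y') :
    β = β' ∧ y = y' := by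
  have hl : y.length = y'.length := by
    have := congrArg List.length h
    simp at this; exact this
  have hb : ∀ n < 3 * (y.length + 1), encBit β y n = encBit β' y' n := fun n hn => by
    rw [← getD_enc β y hn, h, getD_enc β' y' (by omega)]
  refine ⟨hb 0 (by omega), ext_getD hl fun n hn => ?_⟩
  rw [← encBit_payload β, ← encBit_payload β', hb _ (by omega)]

/-- The end bits make the encoding a prefix code, so the two parts of a concatenation are determined. -/
theorem enc_append_injective {β β' γ γ' : Bool} {y y' z z' : List Bool}
    (h : enc β y ++ enc γ z = enc β' y' ++ enc γ' z') : y = y' ∧ z = z' := by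
  have key : ∀ {β β' : Bool} {y y' l l' : List Bool}, enc β y ++ l = enc β' y' ++ l' →
      ¬ y.length < y'.length := by
    intro β β' y y' l l' h hlt
    have h1 := congrArg (fun l => List.getD l (3 * y.length + 2) false) h
    rw [List.getD_append _ _ _ _ (by simp; omega), List.getD_append _ _ _ _ (by simp; omega),
      getD_enc _ _ (by omega), getD_enc _ _ (by omega), encBit_last, encBit_last] at h1
    simp at h1
    omega
  have hl : y.length = y'.length := by
    have h1 := key h
    have h2 := key h.symm
    omega
  obtain ⟨h1, h2⟩ := List.append_inj h (by simp [hl])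
  exact ⟨(enc_injective h1).2, (enc_injective h2).2⟩

/-- The choice bits from position `a` on describe an accepting path with `v` bits iff they begin with
the code of one. -/
theorem accepts_iff {N : Machine} {a v : ℕ} {β : Bool} :
    (Y a = β ∧ Accepts N R x k Y a v) ↔ ∃ y : List Bool, y.length = v ∧
      N.IsAcceptingPath R x k y ∧ ∀ n < 3 * (v + 1), Y (a + n) = encBit β y n := by
  constructor
  · rintro ⟨hβ, T, hT, hacc, hv, hM, hl⟩
    set y := (List.range v).map (payload Y a) with hy
    have hyl : y.length = v := by simp [hy]
    have hyj : ∀ j < v, payload Y a j = y.getD j false := fun j hj => by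
      simp [hy, List.getD_eq_getElem?_getD, hj]
    refine ⟨y, hyl, ⟨T, ?_⟩, fun n hn => ?_⟩
    · rw [← hv] at hyj
      rw [haltedAt_congr hyj, cfgAt_congr hyj, hyl]
      exact ⟨hT, hacc, hv⟩
    · obtain ⟨j, r, hr, rfl⟩ : ∃ j r, r < 3 ∧ n = 3 * j + r := ⟨n / 3, n % 3, by omega, by omega⟩
      interval_cases r
      · rcases j with _ | j
        · simpa [encBit_zero] using hβ
        · rw [add_zero, encBit_payload, ← hyj j (by omega)]; rfl
      · rw [encBit_start]
        rcases j with _ | j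
        · simpa using hM.start
        · simpa [add_assoc] using hM.inner (j + 1) (by omega) (by omega)
      · rw [encBit_last, hyl]
        rcases (show j ≤ v by omega).eq_or_lt with rfl | hj
        · simpa [add_assoc] using hl
        · simpa [add_assoc, hj.ne] using hM.last j hj
  · rintro ⟨y, hyl, ⟨T, hT, hacc, hv⟩, hY⟩
    have hyj : ∀ j < y.length, y.getD j false = payload Y a j := fun j hj => by
      rw [payload, hY _ (by omega), encBit_payload]
    rw [← hv] at hyj
    refine ⟨by simpa [encBit_zero] using hY 0 (by omega), T, (haltedAt_congr hyj).2 hT, ?_, ?_,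
      ⟨?_, fun j h0 hj => ?_, fun j hj => ?_⟩, ?_⟩
    · rw [cfgAt_congr hyj]; exact hacc
    · rw [cfgAt_congr hyj, hv, hyl]
    · rw [hY 1 (by omega)]; exact encBit_start β y 0
    · rw [add_assoc, hY _ (by omega), encBit_start]; simp; omega
    · rw [add_assoc, hY _ (by omega), encBit_last]; simp; omega
    · rw [add_assoc, hY _ (by omega), encBit_last]; simp [hyl]

theorem eq_enc_iff {l y : List Bool} {β : Bool} : l = enc β y ↔
    l.length = 3 * (y.length + 1) ∧ ∀ n < 3 * (y.length + 1), l.getD n false = encBit β y n := by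
  constructor
  · rintro rfl
    exact ⟨by simp, fun n hn => getD_enc β y hn⟩
  · rintro ⟨h1, h2⟩
    refine ext_getD (by simp [h1]) fun n hn => ?_
    rw [length_enc] at hn
    rw [h2 n hn, getD_enc β y hn]

theorem eq_enc_append_iff {l y z : List Bool} {β γ : Bool} : l = enc β y ++ enc γ z ↔
    l.length = 3 * (y.length + 1) + 3 * (z.length + 1) ∧
      (∀ n < 3 * (y.length + 1), l.getD n false = encBit β y n) ∧
      ∀ n < 3 * (z.length + 1), l.getD (3 * (y.length + 1) + n) false = encBit γ z n := by
  constructor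
  · rintro rfl
    refine ⟨by simp, fun n hn => ?_, fun n hn => ?_⟩
    · rw [List.getD_append _ _ _ _ (by simpa using hn), getD_enc β y hn]
    · rw [List.getD_append_right _ _ _ _ (by simp), length_enc, Nat.add_sub_cancel_left,
        getD_enc γ z hn]
  · rintro ⟨h1, h2, h3⟩
    refine ext_getD (by simp [h1]) fun n hn => ?_
    rcases lt_or_ge n (3 * (y.length + 1)) with h | h
    · rw [h2 n h, List.getD_append _ _ _ _ (by simpa using h), getD_enc β y h]
    · obtain ⟨m, rfl⟩ := Nat.exists_eq_add_of_le h
      have hm : m < 3 * (z.length + 1) := by simp at hn; omega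
      rw [h3 m hm, List.getD_append_right _ _ _ _ (by simp), length_enc, Nat.add_sub_cancel_left,
        getD_enc γ z hm]

theorem outcome_sum_iff {l : List Bool} :
    Outcome false M R x k (fun n => l.getD n false) l.length ↔
      ∃ i y, (M i).IsAcceptingPath R x k y ∧ l = enc i y := by
  constructor
  · rintro ⟨v, hv, hw⟩
    obtain ⟨y, rfl, hy, hb⟩ := accepts_iff.1 ⟨rfl, hv⟩
    exact ⟨_, y, hy, eq_enc_iff.2 ⟨hw, fun n hn => by simpa using hb n hn⟩⟩
  · rintro ⟨i, y, hy, hl⟩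
    obtain ⟨h1, h2⟩ := eq_enc_iff.1 hl
    obtain ⟨h3, h4⟩ := accepts_iff (Y := fun n => l.getD n false) (a := 0).2
      ⟨y, rfl, hy, fun n hn => by simpa using h2 n hn⟩
    refine ⟨y.length, ?_, h1⟩
    subst h3
    exact h4

theorem outcome_mul_iff {l : List Bool} :
    Outcome true M R x k (fun n => l.getD n false) l.length ↔
      ∃ y z, (M false).IsAcceptingPath R x k y ∧ (M true).IsAcceptingPath R x k z ∧
        l = enc false y ++ enc true z := by
  constructor
  · rintro ⟨v, v', h0, hv, h0', hv', hw⟩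
    obtain ⟨y, rfl, hy, hb⟩ := accepts_iff.1 ⟨h0, hv⟩
    obtain ⟨z, rfl, hz, hb'⟩ := accepts_iff.1 ⟨h0', hv'⟩
    exact ⟨y, z, hy, hz, eq_enc_append_iff.2 ⟨hw, fun n hn => by simpa using hb n hn, hb'⟩⟩
  · rintro ⟨y, z, hy, hz, hl⟩
    obtain ⟨h1, h2, h3⟩ := eq_enc_append_iff.1 hl
    obtain ⟨h4, h5⟩ := accepts_iff (Y := fun n => l.getD n false) (a := 0).2
      ⟨y, rfl, hy, fun n hn => by simpa using h2 n hn⟩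
    obtain ⟨h6, h7⟩ := accepts_iff (Y := fun n => l.getD n false) (a := 3 * (y.length + 1)).2
      ⟨z, rfl, hz, h3⟩
    exact ⟨_, _, h4, h5, h6, h7, h1⟩

theorem encard_outcome_sum :
    {l : List Bool | Outcome false M R x k (fun n => l.getD n false) l.length}.encard =
      (M false).acc R x k + (M true).acc R x k := by
  have hset : {l : List Bool | Outcome false M R x k (fun n => l.getD n false) l.length} =
      enc false '' {y | (M false).IsAcceptingPath R x k y} ∪
        enc true '' {y | (M true).IsAcceptingPath R x k y} := by
    ext l
    rw [Set.mem_ofPred_eq, outcome_sum_iff]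
    simp [Bool.exists_bool, eq_comm]
  have hdis : Disjoint (enc false '' {y | (M false).IsAcceptingPath R x k y})
      (enc true '' {y | (M true).IsAcceptingPath R x k y}) := by
    rw [Set.disjoint_left]
    rintro _ ⟨y, -, rfl⟩ ⟨y', -, h⟩
    exact Bool.noConfusion (enc_injective h).1
  rw [hset, Set.encard_union_eq hdis, Set.InjOn.encard_image, Set.InjOn.encard_image]
  · rfl
  · exact fun _ _ _ _ h => (enc_injective h).2
  · exact fun _ _ _ _ h => (enc_injective h).2

theorem encard_outcome_mul :
    {l : List Bool | Outcome true M R x k (fun n => l.getD n false) l.length}.encard =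
      (M false).acc R x k * (M true).acc R x k := by
  have hset : {l : List Bool | Outcome true M R x k (fun n => l.getD n false) l.length} =
      (fun p : List Bool × List Bool => enc false p.1 ++ enc true p.2) ''
        ({y | (M false).IsAcceptingPath R x k y} ×ˢ {z | (M true).IsAcceptingPath R x k z}) := by
    ext l
    rw [Set.mem_ofPred_eq, outcome_mul_iff]
    simp [eq_comm, and_assoc]
  rw [hset, Set.InjOn.encard_image, Set.encard_prod]
  · rfl
  · rintro ⟨y, z⟩ - ⟨y', z'⟩ - h
    obtain ⟨rfl, rfl⟩ := enc_append_injective h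
    rfl

end Comb

/-! ### Resource bounds -/

theorem one_le_lg (n : ℕ) : 1 ≤ lg n := le_max_left _ _

theorem lg_mono {m n : ℕ} (h : m ≤ n) : lg m ≤ lg n :=
  max_le_max le_rfl (Nat.clog_mono_right 2 h)

theorem lg_le {n : ℕ} (h : 1 ≤ n) : lg n ≤ n :=
  max_le h (Nat.clog_le_of_le_pow Nat.lt_two_pow_self.le)

theorem lg_add_le (n m : ℕ) : lg (n + m) ≤ lg n + m := by
  induction m with
  | zero => exact le_rfl
  | succ m ih =>
    have h1 : n + m ≤ 2 ^ lg (n + m) :=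
      (Nat.le_pow_clog one_lt_two _).trans (Nat.pow_le_pow_right two_pos (le_max_right _ _))
    have h2 : n + m + 1 ≤ 2 ^ (lg (n + m) + 1) := by
      have := Nat.one_le_two_pow (n := lg (n + m))
      rw [pow_succ]; omega
    have h3 : Nat.clog 2 (n + m + 1) ≤ lg (n + m) + 1 := Nat.clog_le_of_le_pow h2
    have h4 : lg (n + (m + 1)) ≤ lg (n + m) + 1 := max_le (by omega) h3
    omega

/-- Logarithmic space is bounded by a function of the parameter times the logarithm of the length of
the word. -/
theorem lg_add_le_mul (n m : ℕ) : lg (n + m) ≤ (m + 1) * lg n := by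
  have h1 := lg_add_le n m
  have h2 := Nat.mul_le_mul_left m (one_le_lg n)
  rw [add_mul]; omega

theorem computable_add {f g : ℕ → ℕ} (hf : Computable f) (hg : Computable g) :
    Computable fun k => f k + g k := Primrec.nat_add.to_comp.comp hf hg

theorem computable_mul {f g : ℕ → ℕ} (hf : Computable f) (hg : Computable g) :
    Computable fun k => f k * g k := Primrec.nat_mul.to_comp.comp hf hg

namespace Comb

open Machine

variable {M : Bool → Machine} {R : InputRelations}

/-- Common bounds for the space, the time and the number of choice bits of two machines. -/
theorem exists_bounds (hL : ∀ i, (M i).IsParaL R) (hB : ∀ i, (M i).IsKBounded R) :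
    ∃ (c e : ℕ) (f b : ℕ → ℕ), Computable f ∧ Computable b ∧ ∀ x k, b k + 1 ≤ f k ∧
      AllSmall R x k (c * lg (x.length + f k)) M ∧
      (∀ i y, (M i).HaltedAt R x k y (c * (x.length + f k) ^ e)) ∧
      ∀ i y t, ((M i).cfgAt R x k y t).visited ≤ b k * lg x.length := by
  choose c d f hf h using hL
  choose b hb h' using hB
  refine ⟨c false + c true, d false + d true,
    fun k => (f false k + f true k) + ((b false k + b true k) + 1),
    fun k => b false k + b true k,
    computable_add (computable_add (hf _) (hf _))
      (computable_add (computable_add (hb _) (hb _)) (Computable.const 1)),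
    computable_add (hb _) (hb _), fun x k => ?_⟩
  beta_reduce
  refine ⟨by omega, ?_, ?_, ?_⟩
  · intro i y t
    refine ⟨fun τ => pos_lt_length t τ, fun τ => ?_⟩
    have h1 := pos_lt_length (M := M i) (R := R) (x := x) (k := k) (y := y) t τ
    have h2 := length_le_space ((M i).cfgAt R x k y t) τ
    have h3 := (h i x k y).1 t
    have h4 : c i ≤ c false + c true := by cases i <;> omega
    have h5 : x.length + f i k ≤
        x.length + ((f false k + f true k) + ((b false k + b true k) + 1)) := by
      cases i <;> omega
    have h6 := Nat.mul_le_mul h4 (lg_mono h5)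
    omega
  · intro i y
    refine (h i x k y).2.mono ?_
    have h4 : c i ≤ c false + c true := by cases i <;> omega
    have h5 : x.length + f i k ≤
        x.length + ((f false k + f true k) + ((b false k + b true k) + 1)) := by
      cases i <;> omega
    have h6 : d i ≤ d false + d true := by cases i <;> omega
    exact Nat.mul_le_mul h4 ((Nat.pow_le_pow_left h5 _).trans (Nat.pow_le_pow_right (by omega) h6))
  · intro i y t
    refine (h' i x k y t).trans (Nat.mul_le_mul_right _ ?_)
    cases i <;> omega

theorem visited_le_of_haltedAt {N : Machine} {x : List Bool} {k : ℕ} {y : ℕ → Bool} {t₁ : ℕ}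
    (h : N.HaltedAt R x k y t₁) (t : ℕ) :
    (N.cfgAt R x k y t).visited ≤ (N.cfgAt R x k y t₁).visited := by
  rcases le_total t t₁ with ht | ht
  · exact visited_mono ht
  · rw [cfgAt_of_haltedAt h ht]

theorem length_le_of_haltedAt {N : Machine} {x : List Bool} {k : ℕ} {y : ℕ → Bool} {t₁ : ℕ}
    (h : N.HaltedAt R x k y t₁) (t : ℕ) (τ : TapeIx N.Work) :
    ((N.cfgAt R x k y t).tapes τ).cells.length ≤ ((N.cfgAt R x k y t₁).tapes τ).cells.length := by
  rcases le_total t t₁ with ht | ht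
  · exact length_mono ht τ
  · rw [cfgAt_of_haltedAt h ht]

theorem isParaL (prod : Bool) (hL : ∀ i, (M i).IsParaL R) (hB : ∀ i, (M i).IsKBounded R) :
    (comb prod M).IsParaL R := by
  obtain ⟨c, e, f, b, hf, hb, h⟩ := exists_bounds hL hB
  set K := @Fintype.card (comb prod M).Work (comb prod M).finWork + 2 with hK
  refine ⟨K * (c + 1) + (42 * c + 36), e + 2, f, hf, fun x k y => ?_⟩
  obtain ⟨hbf, hS, hT, hV⟩ := h x k
  obtain ⟨t₀, t₁, ht₀, ht₁, -, hH, -, -, hlen⟩ := comb_run prod y hS hT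
    (fun i y t _ _ => (hT i y).mono (Nat.le_add_left _ t)) hV
  set N := x.length + f k with hN
  have hN1 : 1 ≤ N := by omega
  have hlg := one_le_lg N
  constructor
  · intro t
    refine (space_le _ (c * lg N + 1) fun τ => (length_le_of_haltedAt hH t τ).trans (hlen τ)).trans ?_
    rw [← hK]
    calc K * (c * lg N + 1) ≤ K * ((c + 1) * lg N) := by
          refine Nat.mul_le_mul_left _ ?_
          rw [add_mul]; omega
      _ = (K * (c + 1)) * lg N := by ring
      _ ≤ _ := Nat.mul_le_mul_right _ (Nat.le_add_right _ _)
  · refine hH.mono (ht₁.trans ?_)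
    have hP1 : N ^ e ≤ N ^ (e + 2) := Nat.pow_le_pow_right hN1 (by omega)
    have hP2 : N ^ 2 ≤ N ^ (e + 2) := Nat.pow_le_pow_right hN1 (by omega)
    have hP3 : N ≤ N ^ (e + 2) := Nat.le_self_pow (by omega) N
    have h1 : c * N ^ e ≤ c * N ^ (e + 2) := Nat.mul_le_mul_left _ hP1
    have h2 : c * lg N ≤ c * N ^ (e + 2) := Nat.mul_le_mul_left _ ((lg_le hN1).trans hP3)
    have h3 : b k * lg x.length ≤ N ^ (e + 2) := by
      refine le_trans ?_ hP2
      rw [pow_two]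
      exact Nat.mul_le_mul (by omega) ((lg_mono (by omega)).trans (lg_le hN1))
    have h4 : (42 * c + 36) * N ^ (e + 2) = 42 * (c * N ^ (e + 2)) + 36 * N ^ (e + 2) := by ring
    have h5 : (42 * c + 36) * N ^ (e + 2) ≤ (K * (c + 1) + (42 * c + 36)) * N ^ (e + 2) :=
      Nat.mul_le_mul_right _ (Nat.le_add_left _ _)
    omega

theorem isKBounded (prod : Bool) (hL : ∀ i, (M i).IsParaL R) (hB : ∀ i, (M i).IsKBounded R) :
    (comb prod M).IsKBounded R := by
  obtain ⟨c, e, f, b, hf, hb, h⟩ := exists_bounds hL hB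
  refine ⟨fun k => 6 * (b k + 1), computable_mul (Computable.const 6)
    (computable_add hb (Computable.const 1)), fun x k y t => ?_⟩
  obtain ⟨hbf, hS, hT, hV⟩ := h x k
  obtain ⟨t₀, t₁, ht₀, ht₁, -, hH, -, hvis, -⟩ := comb_run prod y hS hT
    (fun i y t _ _ => (hT i y).mono (Nat.le_add_left _ t)) hV
  have h1 := visited_le_of_haltedAt hH t
  have h2 := one_le_lg x.length
  beta_reduce
  have h3 : 6 * (b k + 1) * lg x.length = 6 * (b k * lg x.length) + 6 * lg x.length := by ring
  omega

theorem isTail (prod : Bool) (hL : ∀ i, (M i).IsParaL R) (hB : ∀ i, (M i).IsKBounded R)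
    (hT : ∀ i, (M i).IsTail R) : (comb prod M).IsTail R := by
  obtain ⟨c, e, f, b, hf, hb, h⟩ := exists_bounds hL hB
  choose g hg hg' using hT
  -- the number of steps after the deterministic part in `comb_run`, with the space bound
  -- `c * lg (|x| + f k)` estimated by `lg_add_le_mul`
  refine ⟨fun k => 8 * (c * (f k + 1)) + (24 * ((g false k + g true k) + 1) + (4 * b k + 20)), ?_,
    fun x k y t ht => ?_⟩
  · refine computable_add (computable_mul (Computable.const 8) (computable_mul (Computable.const c)
      (computable_add hf (Computable.const 1)))) (computable_add (computable_mul
      (Computable.const 24) (computable_add (computable_add (hg _) (hg _)) (Computable.const 1)))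
      (computable_add (computable_mul (Computable.const 4) hb) (Computable.const 20)))
  obtain ⟨hbf, hS, hT, hV⟩ := h x k
  set ℓ := lg x.length with hℓ
  have hd : ∀ i y t, ((M i).cfgAt R x k y t).visited = 0 →
      ((M i).HaltedAt R x k y t ∨ 0 < ((M i).cfgAt R x k y (t + 1)).visited) →
      (M i).HaltedAt R x k y (t + ((g false k + g true k) * ℓ + 1)) := by
    intro i y t _ hs
    have h2 : g i k * ℓ ≤ (g false k + g true k) * ℓ :=
      Nat.mul_le_mul_right _ (by cases i <;> omega)
    rcases hs with hs | hs
    · exact hs.mono (by omega)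
    · have hH := hg' i x k y _ hs
      rw [← hℓ] at hH
      exact hH.mono (by omega)
  obtain ⟨t₀, t₁, -, ht₁, hv₀, hH, -, -, -⟩ := comb_run prod y hS hT hd hV
  have ht₀ : t₀ ≤ t := by
    by_contra hlt
    have := visited_mono (M := comb prod M) (R := R) (x := x) (k := k) (y := y)
      (le_of_not_ge hlt)
    omega
  refine hH.mono ?_
  beta_reduce
  have h1 := Nat.mul_le_mul_left c (lg_add_le_mul x.length (f k))
  rw [← hℓ] at h1
  have h2 : 1 ≤ ℓ := one_le_lg _
  have h3 : (8 * (c * (f k + 1)) + (24 * ((g false k + g true k) + 1) + (4 * b k + 20))) * ℓ =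
      8 * (c * ((f k + 1) * ℓ)) + (24 * ((g false k + g true k) * ℓ) + 24 * ℓ +
        (4 * (b k * ℓ) + 20 * ℓ)) := by ring
  omega

theorem acc_eq (prod : Bool) (hL : ∀ i, (M i).IsParaL R) (hB : ∀ i, (M i).IsKBounded R)
    (x : List Bool) (k : ℕ) : (comb prod M).acc R x k =
      {l : List Bool | Outcome prod M R x k (fun n => l.getD n false) l.length}.encard := by
  obtain ⟨c, e, f, b, hf, hb, h⟩ := exists_bounds hL hB
  obtain ⟨hbf, hS, hT, hV⟩ := h x k
  unfold acc
  congr 1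
  ext l
  rw [Set.mem_ofPred_eq, Set.mem_ofPred_eq]
  obtain ⟨t₀, t₁, -, -, -, hH, hacc, -, -⟩ := comb_run prod (fun n => l.getD n false) hS hT
    (fun i y t _ _ => (hT i y).mono (Nat.le_add_left _ t)) hV
  rw [← hacc]
  constructor
  · rintro ⟨t, ht, h1, h2⟩
    rw [HaltedAt.cfgAt_eq ht hH] at h1 h2
    exact ⟨h1, h2⟩
  · rintro ⟨h1, h2⟩
    exact ⟨t₁, hH, h1, h2⟩

theorem counts_add {F : Bool → ParamFun} (hL : ∀ i, (M i).IsParaL R)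
    (hB : ∀ i, (M i).IsKBounded R) (hF : ∀ i, (M i).Counts R (F i)) :
    (comb false M).Counts R fun x k => F false x k + F true x k := by
  intro x k
  rw [acc_eq false hL hB, encard_outcome_sum, hF, hF, Nat.cast_add]

theorem counts_mul {F : Bool → ParamFun} (hL : ∀ i, (M i).IsParaL R)
    (hB : ∀ i, (M i).IsKBounded R) (hF : ∀ i, (M i).Counts R (F i)) :
    (comb true M).Counts R fun x k => F false x k * F true x k := by
  intro x k
  rw [acc_eq true hL hB, encard_outcome_mul, hF, hF, Nat.cast_mul]

end Comb

/-- A counting class is closed under sums and products if its defining property `P` of machines is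
inherited by the combined machines. -/
theorem closedUnderAddMul_of_comb {R : InputRelations} {P : Machine → Prop}
    (hL : ∀ N, P N → N.IsParaL R) (hB : ∀ N, P N → N.IsKBounded R)
    (hP : ∀ prod (M : Bool → Machine), (∀ i, P (M i)) → P (comb prod M)) :
    ClosedUnderAddMul {F | ∃ N : Machine, P N ∧ N.Counts R F} := by
  rintro F ⟨N, hN, hF⟩ G ⟨N', hN', hG⟩
  have hM : ∀ i : Bool, P (bif i then N' else N) := Bool.forall_bool.2 ⟨hN, hN'⟩
  have hFG : ∀ i : Bool, (bif i then N' else N).Counts R (bif i then G else F) :=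
    Bool.forall_bool.2 ⟨hF, hG⟩
  exact ⟨⟨_, hP false _ hM, Comb.counts_add (fun i => hL _ (hM i)) (fun i => hB _ (hM i)) hFG⟩,
    ⟨_, hP true _ hM, Comb.counts_mul (fun i => hL _ (hM i)) (fun i => hB _ (hM i)) hFG⟩⟩

end ParaLog

theorem mainTheorem10 (R : ParaLog.InputRelations) :
    ParaLog.ClosedUnderAddMul (ParaLog.SharpParaWL R) ∧
    ParaLog.ClosedUnderAddMul (ParaLog.SharpParaWTailL R) ∧
    ParaLog.ClosedUnderAddMul (ParaLog.SharpParaBetaL R) ∧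
    ParaLog.ClosedUnderAddMul (ParaLog.SharpParaBetaTailL R) := by
  refine ⟨?_, ?_, ?_, ?_⟩
  · have := ParaLog.closedUnderAddMul_of_comb (R := R)
      (P := fun N => N.IsParaL R ∧ N.IsKBounded R)
      (fun _ h => h.1) (fun _ h => h.2) fun prod M h =>
        ⟨ParaLog.Comb.isParaL prod (fun i => (h i).1) fun i => (h i).2,
          ParaLog.Comb.isKBounded prod (fun i => (h i).1) fun i => (h i).2⟩
    simpa only [ParaLog.SharpParaWL, and_assoc] using this
  · have := ParaLog.closedUnderAddMul_of_comb (R := R)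
      (P := fun N => N.IsParaL R ∧ N.IsKBounded R ∧ N.IsTail R)
      (fun _ h => h.1) (fun _ h => h.2.1) fun prod M h =>
        ⟨ParaLog.Comb.isParaL prod (fun i => (h i).1) fun i => (h i).2.1,
          ParaLog.Comb.isKBounded prod (fun i => (h i).1) fun i => (h i).2.1,
          ParaLog.Comb.isTail prod (fun i => (h i).1) (fun i => (h i).2.1) fun i => (h i).2.2⟩
    simpa only [ParaLog.SharpParaWTailL, and_assoc] using this
  · have := ParaLog.closedUnderAddMul_of_comb (R := R)
      (P := fun N => N.IsParaL R ∧ N.IsKBounded R ∧ N.IsReadOnce)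
      (fun _ h => h.1) (fun _ h => h.2.1) fun prod M h =>
        ⟨ParaLog.Comb.isParaL prod (fun i => (h i).1) fun i => (h i).2.1,
          ParaLog.Comb.isKBounded prod (fun i => (h i).1) fun i => (h i).2.1,
          ParaLog.comb_isReadOnce prod M fun i => (h i).2.2⟩
    simpa only [ParaLog.SharpParaBetaL, and_assoc] using this
  · have := ParaLog.closedUnderAddMul_of_comb (R := R)
      (P := fun N => N.IsParaL R ∧ N.IsKBounded R ∧ N.IsReadOnce ∧ N.IsTail R)
      (fun _ h => h.1) (fun _ h => h.2.1) fun prod M h =>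
        ⟨ParaLog.Comb.isParaL prod (fun i => (h i).1) fun i => (h i).2.1,
          ParaLog.Comb.isKBounded prod (fun i => (h i).1) fun i => (h i).2.1,
          ParaLog.comb_isReadOnce prod M fun i => (h i).2.2.1,
          ParaLog.Comb.isTail prod (fun i => (h i).1) (fun i => (h i).2.1) fun i => (h i).2.2.2⟩
    simpa only [ParaLog.SharpParaBetaTailL, and_assoc] using this
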